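/- Let $\mathbb{K}$ be $\mathbb{R}$ or $\mathbb{C}$. A Banach sequence space is a Banach space $X\subseteq\mathbb{K}^{\mathbb{N}}$ of scalar sequences such that $\ell_1\subseteq X\subseteq\ell_\infty$ with norm one inclusions and such that, whenever $x\in\mathbb{K}^{\mathbb{N}}$ and $y\in X$ satisfy $|x_n|\le |y_n|$ for all $n$, then $x\in X$ and $\|x\|_X\le\|y\|_X$. It is symmetric if for every $x\in X$ and every permutation $\sigma$ of $\mathbb{N}$ the sequence $(x_{\sigma(n)})_n$ belongs to $X$ and has the same norm as $x$. It is $2$-convex if there is $\kappa>0$ such that for all $N$ and $x_1,\dots,x_N\in X$ $$\Big\|\Big(\big(\textstyle\sum_{j=1}^N |x_j(k)|^2\big)^{1/2}\Big)_{k}\Big\|_X\le \kappa\Big(\sum_{j=1}^N\|x_j\|_X^2\Big)^{1/2},$$ and $2$-concave if there is $\kappa>0$ such that for all $N$ and $x_1,\dots,x_N\in X$ $$\Big(\sum_{j=1}^N\|x_j\|_X^2\Big)^{1/2}\le \kappa\,\Big\|\Big(\big(\textstyle\sum_{j=1}^N |x_j(k)|^2\big)^{1/2}\Big)_{k}\Big\|_X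 .$$ A continuous bilinear form $T:X\times Y\to\mathbb{K}$ is diagonal if there is a scalar sequence $(\alpha_k)_k$ such that $T(x,y)=\sum_{k=1}^\infty \alpha_k x_k y_k$ (a convergent series) for all $x\in X$, $y\in Y$; it is extendible if for all Banach spaces $E\supseteq X$ and $F\supseteq Y$ (isometrically) there is a continuous bilinear form on $E\times F$ that extends $T$. Theorem. Let $X$ and $Y$ be symmetric Banach sequence spaces over $\mathbb{K}$, each of which is $2$-convex or $2$-concave. Then all diagonal bilinear forms on $X\times Y$ are extendible if and only if either $X=Y=\ell_1$ or $X,Y\in\{c_0,\ell_\infty\}$, where equality of sequence spaces means equality as sets of sequences, with equivalent norms. -/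

import Mathlib

open Filter Topology

universe u

/-- A Banach (Köthe) sequence space over `𝕜 = ℝ` or `ℂ`: a linear space of scalar sequences
with a complete norm, such that `ℓ₁ ⊆ X ⊆ ℓ_∞` with norm one inclusions and which is solid
(`|x| ≤ |y|` coordinatewise and `y ∈ X` imply `x ∈ X` and `‖x‖ ≤ ‖y‖`).
That the seminorm is a norm follows from `norm_apply_le`. -/
structure BanachSeqSpace (𝕜 : Type u) [RCLike 𝕜] where
  /-- the underlying linear space of sequences -/
  carrier : Submodule 𝕜 (ℕ → 𝕜)
  /-- the norm -/
  nrm : Seminorm 𝕜 carrier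
  /-- completeness: Cauchy sequences converge in norm -/
  complete : ∀ v : ℕ → carrier,
    (∀ ε : ℝ, 0 < ε → ∃ M, ∀ m, M ≤ m → ∀ n, M ≤ n → nrm (v m - v n) < ε) →
      ∃ x : carrier, Tendsto (fun n => nrm (v n - x)) atTop (𝓝 0)
  /-- `ℓ₁ ⊆ X` with norm at most one -/
  ell_one_le : ∀ x : ℕ → 𝕜, Summable (fun n => ‖x n‖) →
    ∃ hx : x ∈ carrier, nrm ⟨x, hx⟩ ≤ ∑' n, ‖x n‖
  /-- `X ⊆ ℓ_∞` with norm at most one -/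
  norm_apply_le : ∀ (x : carrier) (n : ℕ), ‖(x : ℕ → 𝕜) n‖ ≤ nrm x
  /-- solidity -/
  solid : ∀ (x : ℕ → 𝕜) (y : carrier), (∀ n, ‖x n‖ ≤ ‖(y : ℕ → 𝕜) n‖) →
    ∃ hx : x ∈ carrier, nrm ⟨x, hx⟩ ≤ nrm y

namespace BanachSeqSpace

variable {𝕜 : Type u} [RCLike 𝕜]

/-- The Banach space of elements of `X`. It is a type synonym of the submodule `X.carrier`, so
that its topology is the norm topology and not that of coordinatewise convergence. -/
def Space (X : BanachSeqSpace 𝕜) : Type u := ↥X.carrier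

instance : CoeSort (BanachSeqSpace 𝕜) (Type u) := ⟨Space⟩

variable (X : BanachSeqSpace 𝕜)

instance : CoeFun X (fun _ => ℕ → 𝕜) := ⟨fun x => Subtype.val x⟩

instance : AddCommGroup X := inferInstanceAs (AddCommGroup ↥X.carrier)

instance : Module 𝕜 X := inferInstanceAs (Module 𝕜 ↥X.carrier)

instance : Norm X := ⟨fun x => X.nrm x⟩

theorem normedSpaceCore : NormedSpace.Core 𝕜 X where
  norm_nonneg x := apply_nonneg X.nrm x
  norm_smul c x := map_smul_eq_mul X.nrm c x
  norm_triangle x y := map_add_le_add X.nrm x y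
  norm_eq_zero_iff x := by
    constructor
    · intro h
      apply Subtype.ext
      funext n
      have h1 := X.norm_apply_le x n
      have h2 : X.nrm x = 0 := h
      rw [h2] at h1
      exact norm_le_zero_iff.mp h1
    · rintro rfl
      exact map_zero X.nrm

noncomputable instance : NormedAddCommGroup X := NormedAddCommGroup.ofCore X.normedSpaceCore

noncomputable instance : NormedSpace 𝕜 X := NormedSpace.ofCore X.normedSpaceCore

instance : CompleteSpace X := by
  apply Metric.complete_of_cauchySeq_tendsto
  intro v hv
  obtain ⟨x, hx⟩ := X.complete v (fun ε hε => by
    obtain ⟨M, hM⟩ := Metric.cauchySeq_iff.mp hv ε hε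
    refine ⟨M, fun m hm n hn => ?_⟩
    have := hM m hm n hn
    rw [dist_eq_norm] at this
    exact this)
  exact ⟨x, tendsto_iff_norm_sub_tendsto_zero.mpr hx⟩

/-- `X` is symmetric: it is invariant under permutations of the coordinates, with equality of
norms. -/
def IsSymmetric : Prop :=
  ∀ (σ : Equiv.Perm ℕ) (x : X), ∃ y : X, (∀ n, y n = x (σ n)) ∧ ‖y‖ = ‖x‖

theorem sqrt_sum_sq_mem {N : ℕ} (x : Fin N → X) :
    (fun k => ((Real.sqrt (∑ j, ‖x j k‖ ^ 2) : ℝ) : 𝕜)) ∈ X.carrier := by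
  have h1 : ∀ j, (fun k => ((‖x j k‖ : ℝ) : 𝕜)) ∈ X.carrier := fun j =>
    (X.solid _ (x j) (fun n => by simp)).1
  have h2 : (∑ j, fun k => ((‖x j k‖ : ℝ) : 𝕜)) ∈ X.carrier :=
    Submodule.sum_mem _ (fun j _ => h1 j)
  refine (X.solid _ ⟨_, h2⟩ (fun n => ?_)).1
  have h3 : (0 : ℝ) ≤ ∑ j, ‖x j n‖ := Finset.sum_nonneg (fun j _ => norm_nonneg _)
  simp only [Finset.sum_apply]
  rw [← RCLike.ofReal_sum, RCLike.norm_ofReal, RCLike.norm_ofReal,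
    abs_of_nonneg (Real.sqrt_nonneg _), abs_of_nonneg h3]
  apply Real.sqrt_le_iff.mpr ⟨h3, ?_⟩
  exact Finset.sum_sq_le_sq_sum_of_nonneg (fun j _ => norm_nonneg _)

/-- The sequence `((∑ⱼ |xⱼ(k)|²)^{1/2})ₖ`, an element of `X` by solidity. -/
noncomputable def sqrtSumSq {N : ℕ} (x : Fin N → X) : X :=
  ⟨fun k => ((Real.sqrt (∑ j, ‖x j k‖ ^ 2) : ℝ) : 𝕜), X.sqrt_sum_sq_mem x⟩

/-- `X` is `2`-convex. -/
def IsTwoConvex : Prop :=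
  ∃ κ : ℝ, 0 < κ ∧ ∀ (N : ℕ) (x : Fin N → X),
    ‖X.sqrtSumSq x‖ ≤ κ * Real.sqrt (∑ j, ‖x j‖ ^ 2)

/-- `X` is `2`-concave. -/
def IsTwoConcave : Prop :=
  ∃ κ : ℝ, 0 < κ ∧ ∀ (N : ℕ) (x : Fin N → X),
    Real.sqrt (∑ j, ‖x j‖ ^ 2) ≤ κ * ‖X.sqrtSumSq x‖

/-- `X` is, up to an equivalent norm, the space `S` of sequences with the norm `ν`. -/
def EqUpToEquivNorm (S : Set (ℕ → 𝕜)) (ν : (ℕ → 𝕜) → ℝ) : Prop :=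
  (X.carrier : Set (ℕ → 𝕜)) = S ∧
    ∃ c C : ℝ, 0 < c ∧ 0 < C ∧ ∀ x : X, c * ν x ≤ ‖x‖ ∧ ‖x‖ ≤ C * ν x

/-- `X = ℓ₁` -/
def IsEllOne : Prop :=
  X.EqUpToEquivNorm {x | Summable (fun n => ‖x n‖)} (fun x => ∑' n, ‖x n‖)

/-- `X = c₀` -/
def IsCZero : Prop :=
  X.EqUpToEquivNorm {x | Tendsto x atTop (𝓝 0)} (fun x => ⨆ n, ‖x n‖)

/-- `X = ℓ_∞` -/
def IsEllInfty : Prop :=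
  X.EqUpToEquivNorm {x | BddAbove (Set.range (fun n => ‖x n‖))} (fun x => ⨆ n, ‖x n‖)

variable {X} {Y : BanachSeqSpace 𝕜}

/-- The continuous bilinear form `T` on `X × Y` is diagonal: `T(x, y) = ∑ₖ αₖ xₖ yₖ` for some
scalar sequence `α`, the series converging for all `x ∈ X`, `y ∈ Y`. -/
def IsDiagonal (T : X →L[𝕜] Y →L[𝕜] 𝕜) : Prop :=
  ∃ α : ℕ → 𝕜, ∀ (x : X) (y : Y),
    Tendsto (fun n => ∑ k ∈ Finset.range n, α k * x k * y k) atTop (𝓝 (T x y))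

end BanachSeqSpace

/-- A continuous bilinear form `T` on `X × Y` is extendible if for all Banach spaces `E ⊇ X`,
`F ⊇ Y` it extends to a continuous bilinear form on `E × F`. Superspaces are given by linear
isometric embeddings. The universe is large enough to contain the spaces of bounded functions on
the dual balls of `X` and `Y`, and by injectivity of these an extension to them gives an extension
to any pair of superspaces whatsoever. -/
def IsExtendible {𝕜 : Type u} [RCLike 𝕜] {X Y : Type u}
    [NormedAddCommGroup X] [NormedSpace 𝕜 X] [NormedAddCommGroup Y] [NormedSpace 𝕜 Y]
    (T : X →L[𝕜] Y →L[𝕜] 𝕜) : Prop :=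
  ∀ (E F : Type u) [NormedAddCommGroup E] [NormedSpace 𝕜 E] [CompleteSpace E]
    [NormedAddCommGroup F] [NormedSpace 𝕜 F] [CompleteSpace F]
    (i : X →ₗᵢ[𝕜] E) (j : Y →ₗᵢ[𝕜] F),
    ∃ B : E →L[𝕜] F →L[𝕜] 𝕜, ∀ (x : X) (y : Y), B (i x) (j y) = T x y

/-!
Write `φ_X(n)` for the norm in `X` of the indicator of the first `n` integers.

**Necessity.** An extendible form on `X × Y` extends to the spaces of bounded functions on the dual
unit balls, where Grothendieck's inequality (`grothendieck_inequality`) applies. So it satisfies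
`|∑ᵢ T(xᵢ, yᵢ)| ≤ L w₂(x) w₂(y)`, where `w₂` is the weak `ℓ₂`-norm of a family
(`IsExtendible.exists_bound`). Test this on unit vectors. If all diagonal forms are extendible, then
a condensation of singularities gives, with a constant independent of `n`,
`n ≤ D ‖T_n‖ w₂(e_k; k < n; X) w₂(e_k; k < n; Y)` for `T_n(x, y) = ∑_{k < n} xₖ yₖ`
(`BanachSeqSpace.exists_le_of_forall_isExtendible`). The three factors are estimated by comparison
with `ℓ₂`. In a symmetric space, the square function of the cyclic shifts of a vector supported on
the first `n` integers is constant there. Hence, up to constants and on such vectors, `2`-convexity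
implies `φ_X(n) n^{-1/2} ‖x‖₂ ≤ ‖x‖ ≤ ‖x‖₂`, and `2`-concavity implies
`‖x‖₂ ≤ ‖x‖ ≤ φ_X(n) n^{-1/2} ‖x‖₂`. Inserting these estimates yields:
* both spaces `2`-convex: `φ_X φ_Y` is bounded, so both spaces are `c₀` or `ℓ_∞`;
* both spaces `2`-concave: `φ_X(n) φ_Y(n) ≥ c n²`, so both spaces are `ℓ₁`;
* `X` `2`-convex and `Y` `2`-concave: `n φ_X(n) ≤ C φ_Y(n)`, so `Y = ℓ₁`. Then the norms `‖T_n‖` are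
  bounded and `w₂(e_k; k < n; Y) ≤ √n`, which gives `n ≤ C √n`, a contradiction.

**Sufficiency.** By Hahn–Banach, a diagonal form extends if its sections are combinations of products
of functionals with uniformly bounded norms; the extensions of the sections have a limit along an
ultrafilter (`exists_extension_of_tendsto`). On `c₀` and `ℓ_∞` the coefficients are summable. On
`ℓ₁`, where they are only bounded, `∑ αₖ xₖ yₖ` is the average over all signs `ε` of
`(∑ εₖ αₖ xₖ)(∑ εₖ yₖ)`.
-/

/-! ### Sign averages -/

/-- The sign `±1` encoded by a Boolean. -/
def boolSign (𝕜 : Type u) [RCLike 𝕜] (b : Bool) : 𝕜 := if b then 1 else -1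

section signs

variable {𝕜 : Type u} [RCLike 𝕜]

@[simp]
theorem boolSign_true : boolSign 𝕜 true = 1 := rfl

@[simp]
theorem boolSign_false : boolSign 𝕜 false = -1 := rfl

theorem norm_boolSign (b : Bool) : ‖boolSign 𝕜 b‖ = 1 := by
  cases b <;> simp

/-- The signed sum `∑ᵢ εᵢ vᵢ`. -/
def signSum {V : Type*} [AddCommGroup V] [Module 𝕜 V] {n : ℕ} (v : Fin n → V)
    (ε : Fin n → Bool) : V :=
  ∑ i, boolSign 𝕜 (ε i) • v i

theorem sum_signs_succ {A : Type*} [AddCommMonoid A] {n : ℕ} (f : (Fin (n + 1) → Bool) → A) :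
    ∑ ε, f ε = ∑ ε : Fin n → Bool, (f (Fin.cons true ε) + f (Fin.cons false ε)) := by
  rw [← (Fin.consEquiv (fun _ => Bool)).sum_comp, Fintype.sum_prod_type, Fintype.sum_bool,
    ← Finset.sum_add_distrib]
  rfl

theorem signSum_cons_true {V : Type*} [AddCommGroup V] [Module 𝕜 V] {n : ℕ}
    (v : Fin (n + 1) → V) (ε : Fin n → Bool) :
    signSum (𝕜 := 𝕜) v (Fin.cons true ε) = signSum (𝕜 := 𝕜) (fun i => v i.succ) ε + v 0 := by
  simp [signSum, Fin.sum_univ_succ, add_comm]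

theorem signSum_cons_false {V : Type*} [AddCommGroup V] [Module 𝕜 V] {n : ℕ}
    (v : Fin (n + 1) → V) (ε : Fin n → Bool) :
    signSum (𝕜 := 𝕜) v (Fin.cons false ε) = signSum (𝕜 := 𝕜) (fun i => v i.succ) ε - v 0 := by
  simp [signSum, Fin.sum_univ_succ, sub_eq_neg_add]

/-- Orthogonality of the signs. -/
theorem sum_signs_bilin {V W : Type*} [AddCommGroup V] [Module 𝕜 V] [AddCommGroup W]
    [Module 𝕜 W] (b : V →ₗ[𝕜] W →ₗ[𝕜] 𝕜) {n : ℕ} (v : Fin n → V) (w : Fin n → W) :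
    ∑ ε, b (signSum (𝕜 := 𝕜) v ε) (signSum (𝕜 := 𝕜) w ε) = 2 ^ n * ∑ i, b (v i) (w i) := by
  induction n with
  | zero => simp [signSum]
  | succ n ih =>
    have h : ∀ ε : Fin n → Bool,
        b (signSum (𝕜 := 𝕜) v (Fin.cons true ε)) (signSum (𝕜 := 𝕜) w (Fin.cons true ε)) +
        b (signSum (𝕜 := 𝕜) v (Fin.cons false ε)) (signSum (𝕜 := 𝕜) w (Fin.cons false ε)) =
        2 * b (signSum (𝕜 := 𝕜) (fun i => v i.succ) ε) (signSum (𝕜 := 𝕜) (fun i => w i.succ) ε)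
          + 2 * b (v 0) (w 0) := by
      intro ε
      simp only [signSum_cons_true, signSum_cons_false, map_add, map_sub, LinearMap.add_apply,
        LinearMap.sub_apply]
      ring
    rw [sum_signs_succ, Finset.sum_congr rfl (fun ε _ => h ε), Finset.sum_add_distrib,
      ← Finset.mul_sum, ih, Fin.sum_univ_succ]
    simp only [Finset.sum_const, Finset.card_univ, Fintype.card_fun, Fintype.card_bool,
      Fintype.card_fin, nsmul_eq_mul]
    push_cast
    ring

theorem norm_add_sq_add_norm_sub_sq (z w : 𝕜) :
    ‖z + w‖ ^ 2 + ‖z - w‖ ^ 2 = 2 * ‖z‖ ^ 2 + 2 * ‖w‖ ^ 2 := by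
  have := parallelogram_law_with_norm 𝕜 z w
  nlinarith

theorem norm_add_pow_four_add_norm_sub_pow_four_le (z w : 𝕜) :
    ‖z + w‖ ^ 4 + ‖z - w‖ ^ 4 ≤ 2 * ‖z‖ ^ 4 + 12 * (‖z‖ ^ 2 * ‖w‖ ^ 2) + 2 * ‖w‖ ^ 4 := by
  have h1 := norm_add_sq_add_norm_sub_sq z w
  have h4 : |‖z + w‖ ^ 2 - ‖z - w‖ ^ 2| ≤ 4 * (‖z‖ * ‖w‖) := by
    have e : ‖z + w‖ ^ 2 - ‖z - w‖ ^ 2 = 4 * RCLike.re (inner 𝕜 z w) := by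
      rw [norm_add_sq (𝕜 := 𝕜), norm_sub_sq (𝕜 := 𝕜)]; ring
    rw [e, abs_mul, abs_of_pos (by norm_num : (0 : ℝ) < 4)]
    gcongr
    exact (RCLike.abs_re_le_norm _).trans (norm_inner_le_norm z w)
  have h5 := sq_le_sq' (neg_le_of_abs_le h4) (le_of_abs_le h4)
  have e : ‖z + w‖ ^ 4 + ‖z - w‖ ^ 4 =
      ((‖z + w‖ ^ 2 + ‖z - w‖ ^ 2) ^ 2 + (‖z + w‖ ^ 2 - ‖z - w‖ ^ 2) ^ 2) / 2 := by ring
  rw [e, h1]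
  linarith [h5, show (4 * (‖z‖ * ‖w‖)) ^ 2 = 16 * (‖z‖ ^ 2 * ‖w‖ ^ 2) by ring]

theorem sum_signs_norm_sq {n : ℕ} (a : Fin n → 𝕜) :
    ∑ ε, ‖signSum (𝕜 := 𝕜) a ε‖ ^ 2 = 2 ^ n * ∑ i, ‖a i‖ ^ 2 := by
  induction n with
  | zero => simp [signSum]
  | succ n ih =>
    rw [sum_signs_succ]
    simp only [signSum_cons_true, signSum_cons_false, norm_add_sq_add_norm_sub_sq]
    rw [Finset.sum_add_distrib, ← Finset.mul_sum, ih, Fin.sum_univ_succ]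
    simp only [Finset.sum_const, Finset.card_univ, Fintype.card_fun, Fintype.card_bool,
      Fintype.card_fin, nsmul_eq_mul]
    push_cast
    ring

/-- Khintchine's inequality for the fourth moment, by induction on the number of summands. -/
theorem sum_signs_norm_pow_four_le {n : ℕ} (a : Fin n → 𝕜) :
    ∑ ε, ‖signSum (𝕜 := 𝕜) a ε‖ ^ 4 ≤ 2 ^ n * (3 * (∑ i, ‖a i‖ ^ 2) ^ 2) := by
  induction n with
  | zero => simp [signSum]
  | succ n ih =>
    rw [sum_signs_succ]
    simp only [signSum_cons_true, signSum_cons_false]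
    refine (Finset.sum_le_sum fun ε _ =>
      norm_add_pow_four_add_norm_sub_pow_four_le _ _).trans ?_
    have h2 := sum_signs_norm_sq (fun i : Fin n => a i.succ)
    have h4 := ih (fun i : Fin n => a i.succ)
    rw [Finset.sum_add_distrib, Finset.sum_add_distrib, ← Finset.mul_sum, ← Finset.mul_sum,
      ← Finset.sum_mul, h2, Fin.sum_univ_succ]
    simp only [Finset.sum_const, Finset.card_univ, Fintype.card_fun, Fintype.card_bool,
      Fintype.card_fin, nsmul_eq_mul]
    push_cast
    have h6 : (0 : ℝ) ≤ 2 ^ n * ‖a 0‖ ^ 4 := by positivity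
    set q := ∑ i : Fin n, ‖a i.succ‖ ^ 2
    have e : (2 : ℝ) ^ (n + 1) * (3 * (‖a 0‖ ^ 2 + q) ^ 2) = 2 * (2 ^ n * (3 * q ^ 2)) +
        12 * (2 ^ n * q * ‖a 0‖ ^ 2) + 6 * (2 ^ n * ‖a 0‖ ^ 4) := by ring
    rw [e]
    linarith

end signs

/-! ### Grothendieck's inequality -/

section grothendieck

variable {𝕜 : Type u} [RCLike 𝕜]

/-- The radial retraction of `𝕜` onto the ball of radius `4`. -/
noncomputable def truncFour (z : 𝕜) : 𝕜 := if ‖z‖ ≤ 4 then z else ((4 / ‖z‖ : ℝ) : 𝕜) * z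

theorem norm_truncFour_le (z : 𝕜) : ‖truncFour z‖ ≤ 4 := by
  unfold truncFour
  split_ifs with h
  · exact h
  · have hz : 0 < ‖z‖ := by linarith
    rw [norm_mul, RCLike.norm_ofReal, abs_of_pos (by positivity), div_mul_cancel₀ _ hz.ne']

theorem norm_truncFour_le_norm (z : 𝕜) : ‖truncFour z‖ ≤ ‖z‖ := by
  by_cases h : ‖z‖ ≤ 4
  · simp [truncFour, h]
  · linarith [norm_truncFour_le z]

theorem norm_sub_truncFour_sq_le (z : 𝕜) : ‖z - truncFour z‖ ^ 2 ≤ ‖z‖ ^ 4 / 16 := by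
  have key : ‖z - truncFour z‖ ≤ ‖z‖ ^ 2 / 4 := by
    unfold truncFour
    split_ifs with h
    · simp; positivity
    · have hz : 4 < ‖z‖ := not_le.1 h
      have e : z - ((4 / ‖z‖ : ℝ) : 𝕜) * z = ((1 - 4 / ‖z‖ : ℝ) : 𝕜) * z := by
        push_cast; ring
      have h1 : 4 / ‖z‖ ≤ 1 := (div_le_one (by linarith)).2 hz.le
      have h0 : 0 < 4 / ‖z‖ := by positivity
      rw [e, norm_mul, RCLike.norm_ofReal, abs_of_nonneg (by linarith)]
      nlinarith
  calc ‖z - truncFour z‖ ^ 2 ≤ (‖z‖ ^ 2 / 4) ^ 2 := by gcongr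
    _ = _ := by ring

variable {S T : Type*}

/-- `K` is a Grothendieck bound for `b`: `|∑ᵢ b(uᵢ, vᵢ)| ≤ K` for all finite families whose
square functions `(∑ᵢ |uᵢ|²)^{1/2}` and `(∑ᵢ |vᵢ|²)^{1/2}` are at most one. -/
def IsGrothendieckBound (b : (S → 𝕜) →ₗ[𝕜] (T → 𝕜) →ₗ[𝕜] 𝕜) (K : ℝ) : Prop :=
  ∀ (n : ℕ) (u : Fin n → S → 𝕜) (v : Fin n → T → 𝕜),
    (∀ s, ∑ i, ‖u i s‖ ^ 2 ≤ 1) → (∀ t, ∑ i, ‖v i t‖ ^ 2 ≤ 1) → ‖∑ i, b (u i) (v i)‖ ≤ K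

theorem IsGrothendieckBound.nonneg {b : (S → 𝕜) →ₗ[𝕜] (T → 𝕜) →ₗ[𝕜] 𝕜} {K : ℝ}
    (h : IsGrothendieckBound b K) : 0 ≤ K := by
  simpa using h 0 (fun _ => 0) (fun _ => 0) (by simp) (by simp)

theorem sum_norm_inv_smul_sq_le_one {ι R : Type*} [Fintype ι] (w : ι → R → 𝕜) {r : ℝ}
    (hr : 0 < r) (hw : ∀ s, ∑ i, ‖w i s‖ ^ 2 ≤ r ^ 2) (s : R) :
    ∑ i : Fin (Fintype.card ι), ‖(((r⁻¹ : ℝ) : 𝕜) • w ((Fintype.equivFin ι).symm i)) s‖ ^ 2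
      ≤ 1 := by
  rw [(Fintype.equivFin ι).symm.sum_comp (fun i => ‖(((r⁻¹ : ℝ) : 𝕜) • w i) s‖ ^ 2)]
  simp only [Pi.smul_apply, norm_smul, RCLike.norm_ofReal, mul_pow, ← Finset.mul_sum]
  rw [sq_abs, inv_pow, inv_mul_le_one₀ (by positivity)]
  exact hw s

theorem IsGrothendieckBound.le {b : (S → 𝕜) →ₗ[𝕜] (T → 𝕜) →ₗ[𝕜] 𝕜} {K : ℝ}
    (h : IsGrothendieckBound b K) {ι : Type*} [Fintype ι] (u : ι → S → 𝕜) (v : ι → T → 𝕜)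
    {p q : ℝ} (hp : 0 < p) (hq : 0 < q) (hu : ∀ s, ∑ i, ‖u i s‖ ^ 2 ≤ p ^ 2)
    (hv : ∀ t, ∑ i, ‖v i t‖ ^ 2 ≤ q ^ 2) : ‖∑ i, b (u i) (v i)‖ ≤ K * (p * q) := by
  have := h _ _ _ (sum_norm_inv_smul_sq_le_one u hp hu)
    (sum_norm_inv_smul_sq_le_one v hq hv)
  rw [(Fintype.equivFin ι).symm.sum_comp
    (fun i => b (((p⁻¹ : ℝ) : 𝕜) • u i) (((q⁻¹ : ℝ) : 𝕜) • v i))] at this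
  simp only [map_smul, LinearMap.smul_apply, smul_eq_mul, ← Finset.mul_sum] at this
  rw [norm_mul, norm_mul, RCLike.norm_ofReal, RCLike.norm_ofReal, abs_of_pos (by positivity),
    abs_of_pos (by positivity)] at this
  rw [← div_le_iff₀ (by positivity)]
  refine le_trans (le_of_eq ?_) this
  field_simp

/-- Every bilinear form on a finite-dimensional space has some Grothendieck bound. -/
theorem exists_isGrothendieckBound [Fintype S] [Fintype T]
    (b : (S → 𝕜) →ₗ[𝕜] (T → 𝕜) →ₗ[𝕜] 𝕜) :
    ∃ K, IsGrothendieckBound b K := by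
  classical
  refine ⟨∑ s, ∑ t, ‖b (Pi.single s 1) (Pi.single t 1)‖, fun n u v hu hv => ?_⟩
  have e : ∀ i, b (u i) (v i) =
      ∑ s, ∑ t, (u i s * v i t) * b (Pi.single s 1) (Pi.single t 1) := by
    intro i
    conv_lhs => rw [pi_eq_sum_univ' (u i), pi_eq_sum_univ' (v i)]
    simp only [map_sum, map_smul, LinearMap.sum_apply, LinearMap.smul_apply, smul_eq_mul,
      Finset.mul_sum, mul_assoc]
    rw [Finset.sum_comm]
    refine Finset.sum_congr rfl fun s _ => Finset.sum_congr rfl fun t _ => ?_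
    simp only [mul_left_comm, ← mul_assoc]
  simp only [e]
  rw [Finset.sum_comm]
  refine (norm_sum_le _ _).trans (Finset.sum_le_sum fun s _ => ?_)
  rw [Finset.sum_comm]
  refine (norm_sum_le _ _).trans (Finset.sum_le_sum fun t _ => ?_)
  rw [← Finset.sum_mul, norm_mul]
  refine mul_le_of_le_one_left (norm_nonneg _) ?_
  calc ‖∑ i, u i s * v i t‖ ≤ ∑ i, (‖u i s‖ ^ 2 + ‖v i t‖ ^ 2) / 2 := by
        refine (norm_sum_le _ _).trans (Finset.sum_le_sum fun i _ => ?_)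
        rw [norm_mul]
        nlinarith [sq_nonneg (‖u i s‖ - ‖v i t‖)]
    _ ≤ 1 := by
        rw [← Finset.sum_div, Finset.sum_add_distrib]
        linarith [hu s, hv t]

/-- The bootstrapping step: replacing the sign sums `∑ᵢ εᵢ uᵢ` by their truncations costs a term
which is again of the same form, but of smaller `L²`-norm by Khintchine's inequality. -/
theorem IsGrothendieckBound.improve {b : (S → 𝕜) →ₗ[𝕜] (T → 𝕜) →ₗ[𝕜] 𝕜} {K β : ℝ}
    (h : IsGrothendieckBound b K)
    (hβ : ∀ x y, (∀ s, ‖x s‖ ≤ 1) → (∀ t, ‖y t‖ ≤ 1) → ‖b x y‖ ≤ β) :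
    IsGrothendieckBound b (16 * β + 7 / 8 * K) := by
  intro n u v hu hv
  have hK := h.nonneg
  set U : (Fin n → Bool) → S → 𝕜 := fun ε => signSum (𝕜 := 𝕜) u ε with hU
  set V : (Fin n → Bool) → T → 𝕜 := fun ε => signSum (𝕜 := 𝕜) v ε with hV
  have Us : ∀ ε s, U ε s = signSum (𝕜 := 𝕜) (fun i => u i s) ε := by
    intro ε s; simp [hU, signSum]
  have Vt : ∀ ε t, V ε t = signSum (𝕜 := 𝕜) (fun i => v i t) ε := by
    intro ε t; simp [hV, signSum]
  set A : (Fin n → Bool) → S → 𝕜 := fun ε s => truncFour (U ε s) with hA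
  set B : (Fin n → Bool) → T → 𝕜 := fun ε t => truncFour (V ε t) with hB
  -- `r` stands for the square root of the number `2 ^ n` of sign vectors
  set r : ℝ := Real.sqrt (2 ^ n) with hr
  have hr0 : 0 < r := Real.sqrt_pos.2 (by positivity)
  have hr2 : r ^ 2 = 2 ^ n := Real.sq_sqrt (by positivity)
  have U2 : ∀ s, ∑ ε, ‖U ε s‖ ^ 2 ≤ r ^ 2 := by
    intro s
    simp only [Us, sum_signs_norm_sq, hr2]
    exact mul_le_of_le_one_right (by positivity) (hu s)
  have V2 : ∀ t, ∑ ε, ‖V ε t‖ ^ 2 ≤ r ^ 2 := by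
    intro t
    simp only [Vt, sum_signs_norm_sq, hr2]
    exact mul_le_of_le_one_right (by positivity) (hv t)
  have A2 : ∀ s, ∑ ε, ‖A ε s‖ ^ 2 ≤ r ^ 2 := fun s =>
    (Finset.sum_le_sum fun ε _ => by
      have := norm_truncFour_le_norm (U ε s)
      simp only [hA]; gcongr).trans (U2 s)
  -- the constant is `√3 / 4 ≤ 7 / 16`, with the factor `3` of Khintchine's inequality
  have tail : ∀ a : Fin n → 𝕜, ∑ i, ‖a i‖ ^ 2 ≤ 1 →
      ∑ ε, ‖signSum (𝕜 := 𝕜) a ε - truncFour (signSum (𝕜 := 𝕜) a ε)‖ ^ 2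
        ≤ (7 / 16 * r) ^ 2 := by
    intro a ha
    refine (Finset.sum_le_sum fun ε _ => norm_sub_truncFour_sq_le _).trans ?_
    rw [← Finset.sum_div, mul_pow, hr2]
    have h1 := sum_signs_norm_pow_four_le a
    have h2 : (∑ i, ‖a i‖ ^ 2) ^ 2 ≤ 1 := pow_le_one₀ (by positivity) ha
    have h3 : (0 : ℝ) < 2 ^ n := by positivity
    nlinarith
  have UA : ∀ s, ∑ ε, ‖(U ε - A ε) s‖ ^ 2 ≤ (7 / 16 * r) ^ 2 := by
    intro s
    simpa only [Pi.sub_apply, hA, Us] using tail _ (hu s)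
  have VB : ∀ t, ∑ ε, ‖(V ε - B ε) t‖ ^ 2 ≤ (7 / 16 * r) ^ 2 := by
    intro t
    simpa only [Pi.sub_apply, hB, Vt] using tail _ (hv t)
  have b1 := h.le (fun ε => U ε - A ε) V (by positivity) hr0 UA V2
  have b2 := h.le A (fun ε => V ε - B ε) hr0 (by positivity) A2 VB
  have b3 : ∀ ε, ‖b (A ε) (B ε)‖ ≤ 16 * β := by
    intro ε
    have h4 : ∀ z : 𝕜, ‖(1 / 4 : 𝕜) * truncFour z‖ ≤ 1 := by
      intro z
      rw [norm_mul]
      have := norm_truncFour_le z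
      have h5 : ‖(1 / 4 : 𝕜)‖ = 1 / 4 := by simp
      rw [h5]; linarith
    have := hβ ((1 / 4 : 𝕜) • A ε) ((1 / 4 : 𝕜) • B ε) (fun s => h4 _) (fun t => h4 _)
    simp only [map_smul, LinearMap.smul_apply, smul_eq_mul, norm_mul] at this
    have h5 : ‖(1 / 4 : 𝕜)‖ = 1 / 4 := by simp
    rw [h5] at this
    linarith
  have b4 : ‖∑ ε, b (A ε) (B ε)‖ ≤ 2 ^ n * (16 * β) := by
    refine (norm_sum_le_of_le _ fun ε _ => b3 ε).trans (le_of_eq ?_)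
    simp
  -- `b(U, V) = b(A, B) + b(U - A, V) + b(A, V - B)`, averaged over the signs
  have e : (2 : 𝕜) ^ n * ∑ i, b (u i) (v i) =
      ∑ ε, b (A ε) (B ε) + ∑ ε, b (U ε - A ε) (V ε) + ∑ ε, b (A ε) (V ε - B ε) := by
    rw [← sum_signs_bilin, ← Finset.sum_add_distrib, ← Finset.sum_add_distrib]
    refine Finset.sum_congr rfl fun ε _ => ?_
    simp only [map_sub, LinearMap.sub_apply, hU, hV]
    ring
  have e2 : (2 : ℝ) ^ n * ‖∑ i, b (u i) (v i)‖ = ‖(2 : 𝕜) ^ n * ∑ i, b (u i) (v i)‖ := by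
    simp [norm_mul, norm_pow]
  have h6 : (2 : ℝ) ^ n * ‖∑ i, b (u i) (v i)‖ ≤ 2 ^ n * (16 * β + 7 / 8 * K) := by
    rw [e2, e]
    refine (norm_add₃_le).trans ?_
    have : K * (7 / 16 * r * r) = 2 ^ n * (7 / 16 * K) := by rw [← hr2]; ring
    have : K * (r * (7 / 16 * r)) = 2 ^ n * (7 / 16 * K) := by rw [← hr2]; ring
    linarith
  exact le_of_mul_le_mul_left h6 (by positivity)

/-- **Grothendieck's inequality**, with the constant `128`. -/
theorem grothendieck_inequality [Fintype S] [Fintype T]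
    (b : (S → 𝕜) →ₗ[𝕜] (T → 𝕜) →ₗ[𝕜] 𝕜) {β : ℝ}
    (hβ : ∀ x y, (∀ s, ‖x s‖ ≤ 1) → (∀ t, ‖y t‖ ≤ 1) → ‖b x y‖ ≤ β) :
    IsGrothendieckBound b (128 * β) := by
  set s : Set ℝ := {K | IsGrothendieckBound b K} with hs
  have hne : s.Nonempty := exists_isGrothendieckBound b
  have hbd : BddBelow s := ⟨0, fun K hK => IsGrothendieckBound.nonneg hK⟩
  -- the best bound `sInf s` does not exceed `16 * β + 7 / 8 * sInf s`
  have hmem : IsGrothendieckBound b (sInf s) := fun n u v hu hv =>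
    le_csInf hne fun K hK => hK n u v hu hv
  have h1 : sInf s ≤ 16 * β + 7 / 8 * sInf s := csInf_le hbd (hmem.improve hβ)
  intro n u v hu hv
  linarith [hmem n u v hu hv]

end grothendieck

/-! ### Extendible forms and weakly square summable families -/

section extendible

/-- The bounded functions on the unit ball of the dual of `X`, an injective superspace of `X`. -/
abbrev DualBallFun (𝕜 : Type u) [RCLike 𝕜] (X : Type u) [NormedAddCommGroup X]
    [NormedSpace 𝕜 X] : Type u :=
  lp (fun _ : {f : X →L[𝕜] 𝕜 // ‖f‖ ≤ 1} => 𝕜) ⊤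

/-- The isometric embedding of `X` into the bounded functions on its dual unit ball. -/
noncomputable def dualBallEmbedding (𝕜 : Type u) [RCLike 𝕜] (X : Type u) [NormedAddCommGroup X]
    [NormedSpace 𝕜 X] : X →ₗᵢ[𝕜] DualBallFun 𝕜 X where
  toFun x := ⟨fun f => f.1 x, memℓp_infty ⟨‖x‖, by
    rintro _ ⟨f, rfl⟩
    exact f.1.le_of_opNorm_le f.2 x |>.trans_eq (one_mul _)⟩⟩
  map_add' x y := by ext f; exact map_add f.1 x y
  map_smul' c x := by ext f; exact map_smul f.1 c x
  norm_map' x := by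
    apply le_antisymm
    · refine lp.norm_le_of_forall_le (norm_nonneg _) fun f => ?_
      exact f.1.le_of_opNorm_le f.2 x |>.trans_eq (one_mul _)
    · obtain ⟨g, hg, hgx⟩ := exists_dual_vector'' 𝕜 x
      have := lp.norm_apply_le_norm (by simp) (E := fun _ : {f : X →L[𝕜] 𝕜 // ‖f‖ ≤ 1} => 𝕜)
        (p := ⊤) ⟨fun f => f.1 x, memℓp_infty ⟨‖x‖, by
          rintro _ ⟨f, rfl⟩
          exact f.1.le_of_opNorm_le f.2 x |>.trans_eq (one_mul _)⟩⟩ ⟨g, hg⟩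
      simp only [hgx] at this
      simpa using this

variable {𝕜 : Type u} [RCLike 𝕜] {X Y : Type u} [NormedAddCommGroup X] [NormedSpace 𝕜 X]
  [NormedAddCommGroup Y] [NormedSpace 𝕜 Y]

theorem dualBallEmbedding_apply (x : X) (f : {f : X →L[𝕜] 𝕜 // ‖f‖ ≤ 1}) :
    dualBallEmbedding 𝕜 X x f = f.1 x := rfl

variable (𝕜) in
/-- The step function on `I` which takes the value `a (c f)` at `f`. -/
noncomputable def stepFun {I S : Type*} [Finite S] (c : I → S) :
    (S → 𝕜) →ₗ[𝕜] lp (fun _ : I => 𝕜) ⊤ where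
  toFun a := ⟨fun f => a (c f), memℓp_infty
    (((Set.finite_range fun s => ‖a s‖).subset (by
      rintro _ ⟨f, rfl⟩; exact ⟨c f, rfl⟩)).bddAbove)⟩
  map_add' _ _ := rfl
  map_smul' _ _ := rfl

theorem stepFun_apply {I S : Type*} [Finite S] (c : I → S) (a : S → 𝕜) (f : I) :
    stepFun 𝕜 c a f = a (c f) := rfl

theorem norm_stepFun_le {I S : Type*} [Finite S] (c : I → S) {a : S → 𝕜}
    (ha : ∀ s, ‖a s‖ ≤ 1) : ‖stepFun 𝕜 c a‖ ≤ 1 :=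
  lp.norm_le_of_forall_le zero_le_one fun f => ha (c f)

/-- Finitely many elements of `X` are uniformly close, on the dual unit ball, to step functions
over a common partition, whose values are values of the given elements. -/
theorem exists_stepFun_near {n : ℕ} (x : Fin n → X) {η : ℝ} (hη : 0 < η) :
    ∃ (N : ℕ) (c : {f : X →L[𝕜] 𝕜 // ‖f‖ ≤ 1} → Fin N)
      (r : Fin N → {f : X →L[𝕜] 𝕜 // ‖f‖ ≤ 1}),
      ∀ i, ‖dualBallEmbedding 𝕜 X (x i) - stepFun 𝕜 c (fun s => (r s).1 (x i))‖ ≤ η := by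
  set g : {f : X →L[𝕜] 𝕜 // ‖f‖ ≤ 1} → (Fin n → 𝕜) := fun f i => f.1 (x i) with hg
  have hb : TotallyBounded (Set.range g) := by
    refine (isCompact_closedBall (0 : Fin n → 𝕜) (∑ i, ‖x i‖)).totallyBounded.subset ?_
    rintro _ ⟨f, rfl⟩
    rw [mem_closedBall_zero_iff, pi_norm_le_iff_of_nonneg (by positivity)]
    intro i
    refine (f.1.le_of_opNorm_le f.2 (x i)).trans ?_
    rw [one_mul]
    exact Finset.single_le_sum (f := fun i => ‖x i‖) (fun _ _ => norm_nonneg _)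
      (Finset.mem_univ i)
  obtain ⟨t, hts, htf, ht⟩ := Metric.finite_approx_of_totallyBounded
    hb η hη
  obtain ⟨N, e⟩ := Finite.exists_equiv_fin t (h := htf)
  obtain ⟨e⟩ := e
  have h1 : ∀ f, ∃ s : t, dist (g f) s < η := fun f => by
    have := ht ⟨f, rfl⟩
    simp only [Set.mem_iUnion, Metric.mem_ball] at this
    obtain ⟨y, hy, hd⟩ := this
    exact ⟨⟨y, hy⟩, hd⟩
  choose c hc using h1
  choose r hr using fun s : t => hts s.2
  refine ⟨N, fun f => e (c f), fun s => r (e.symm s), fun i => ?_⟩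
  refine lp.norm_le_of_forall_le hη.le fun f => ?_
  have h2 := hc f
  rw [← hr, dist_eq_norm] at h2
  have h3 := (norm_le_pi_norm _ i).trans h2.le
  simpa [stepFun_apply, dualBallEmbedding_apply, hg] using h3

/-- Grothendieck's inequality for families in the images of contractions on `ℓ_∞^N`. -/
theorem norm_sum_bilin_le {E F : Type*} [NormedAddCommGroup E] [NormedSpace 𝕜 E]
    [NormedAddCommGroup F] [NormedSpace 𝕜 F] (B : E →L[𝕜] F →L[𝕜] 𝕜) {S S' : Type*}
    [Fintype S] [Fintype S'] (P : (S → 𝕜) →ₗ[𝕜] E) (Q : (S' → 𝕜) →ₗ[𝕜] F)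
    (hP : ∀ a, (∀ s, ‖a s‖ ≤ 1) → ‖P a‖ ≤ 1) (hQ : ∀ a, (∀ s, ‖a s‖ ≤ 1) → ‖Q a‖ ≤ 1)
    {n : ℕ} (u : Fin n → S → 𝕜) (v : Fin n → S' → 𝕜) {p q : ℝ} (hp : 0 < p) (hq : 0 < q)
    (hu : ∀ s, ∑ i, ‖u i s‖ ^ 2 ≤ p ^ 2) (hv : ∀ s, ∑ i, ‖v i s‖ ^ 2 ≤ q ^ 2) :
    ‖∑ i, B (P (u i)) (Q (v i))‖ ≤ 128 * ‖B‖ * (p * q) := by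
  set b : (S → 𝕜) →ₗ[𝕜] (S' → 𝕜) →ₗ[𝕜] 𝕜 :=
    LinearMap.mk₂ 𝕜 (fun a a' => B (P a) (Q a'))
      (by intros; simp) (by intros; simp) (by intros; simp) (by intros; simp)
  refine (grothendieck_inequality b (β := ‖B‖) fun a a' ha ha' => ?_).le u v hp hq hu hv
  refine (B.le_opNorm₂ _ _).trans ?_
  calc ‖B‖ * ‖P a‖ * ‖Q a'‖ ≤ ‖B‖ * 1 * 1 := by
        gcongr
        · exact hP a ha
        · exact hQ a' ha'
    _ = ‖B‖ := by ring

/-- The sum `∑ᵢ B(xᵢ, yᵢ)` depends continuously on the families, so a bound for it may be checked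
on arbitrarily good approximations. -/
theorem norm_sum_bilin_le_of_approx {E F : Type*} [NormedAddCommGroup E] [NormedSpace 𝕜 E]
    [NormedAddCommGroup F] [NormedSpace 𝕜 F] (B : E →L[𝕜] F →L[𝕜] 𝕜) {n : ℕ} (x : Fin n → E)
    (y : Fin n → F) {C : ℝ}
    (h : ∀ η : ℝ, 0 < η → ∃ (x' : Fin n → E) (y' : Fin n → F), (∀ i, ‖x i - x' i‖ ≤ η) ∧
      (∀ i, ‖y i - y' i‖ ≤ η) ∧ ‖∑ i, B (x' i) (y' i)‖ ≤ C) :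
    ‖∑ i, B (x i) (y i)‖ ≤ C := by
  have hclosed : IsClosed {z : (Fin n → E) × (Fin n → F) | ‖∑ i, B (z.1 i) (z.2 i)‖ ≤ C} :=
    isClosed_le (by fun_prop) continuous_const
  have hmem : (x, y) ∈ closure {z : (Fin n → E) × (Fin n → F) |
      ‖∑ i, B (z.1 i) (z.2 i)‖ ≤ C} := by
    rw [Metric.mem_closure_iff]
    intro η hη
    obtain ⟨x', y', hx, hy, hC⟩ := h (η / 2) (half_pos hη)
    refine ⟨(x', y'), hC, ?_⟩
    simp only [← dist_eq_norm] at hx hy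
    rw [Prod.dist_eq, max_lt_iff]
    exact ⟨((dist_pi_le_iff (half_pos hη).le).2 hx).trans_lt (half_lt_self hη),
      ((dist_pi_le_iff (half_pos hη).le).2 hy).trans_lt (half_lt_self hη)⟩
  exact hclosed.closure_subset hmem

/-- Extendible bilinear forms are bounded on pairs of families with bounded weak `ℓ₂`-norms: pass
to the superspaces of bounded functions and apply Grothendieck's inequality there. -/
theorem IsExtendible.exists_bound {T : X →L[𝕜] Y →L[𝕜] 𝕜} (hT : IsExtendible T) :
    ∃ L : ℝ, ∀ (n : ℕ) (x : Fin n → X) (y : Fin n → Y) (p q : ℝ), 0 < p → 0 < q →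
      (∀ f : X →L[𝕜] 𝕜, ‖f‖ ≤ 1 → ∑ i, ‖f (x i)‖ ^ 2 ≤ p ^ 2) →
      (∀ f : Y →L[𝕜] 𝕜, ‖f‖ ≤ 1 → ∑ i, ‖f (y i)‖ ^ 2 ≤ q ^ 2) →
      ‖∑ i, T (x i) (y i)‖ ≤ L * (p * q) := by
  obtain ⟨B, hB⟩ := hT (DualBallFun 𝕜 X) (DualBallFun 𝕜 Y) (dualBallEmbedding 𝕜 X)
    (dualBallEmbedding 𝕜 Y)
  refine ⟨128 * ‖B‖, fun n x y p q hp hq hx hy => ?_⟩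
  have key := norm_sum_bilin_le_of_approx B (fun i => dualBallEmbedding 𝕜 X (x i))
    (fun i => dualBallEmbedding 𝕜 Y (y i)) (C := 128 * ‖B‖ * (p * q)) fun η hη => by
      obtain ⟨N, c, r, h1⟩ := exists_stepFun_near (𝕜 := 𝕜) x hη
      obtain ⟨N', c', r', h2⟩ := exists_stepFun_near (𝕜 := 𝕜) y hη
      exact ⟨_, _, h1, h2, norm_sum_bilin_le B (stepFun 𝕜 c) (stepFun 𝕜 c')
        (fun _ => norm_stepFun_le c) (fun _ => norm_stepFun_le c') _ _ hp hq
        (fun s => hx _ (r s).2) (fun s => hy _ (r' s).2)⟩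
  refine le_trans (le_of_eq ?_) key
  exact congrArg norm (Finset.sum_congr rfl fun i _ => (hB _ _).symm)

/-! ### Constructing extensions -/

/-- The Hahn–Banach theorem for an isometric embedding. -/
theorem exists_dual_extension {E : Type*} [NormedAddCommGroup E] [NormedSpace 𝕜 E]
    (i : X →ₗᵢ[𝕜] E) (f : X →L[𝕜] 𝕜) : ∃ g : E →L[𝕜] 𝕜, (∀ x, g (i x) = f x) ∧ ‖g‖ ≤ ‖f‖ := by
  set e := i.equivRange
  obtain ⟨g, hg, hn⟩ := exists_extension_norm_eq (LinearMap.range i.toLinearMap)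
    (f.comp (e.symm : _ →L[𝕜] X))
  refine ⟨g, fun x => ?_, ?_⟩
  · have := hg (e x)
    simpa [e] using this
  · rw [hn]
    refine ContinuousLinearMap.opNorm_le_bound _ (norm_nonneg _) fun y => ?_
    refine (f.le_opNorm _).trans_eq ?_
    congr 1
    exact e.symm.norm_map y

/-- A pointwise limit of bilinear forms with uniformly bounded extensions is extendible: take the
limit of the extensions along an ultrafilter. -/
theorem exists_extension_of_tendsto {E F : Type*} [NormedAddCommGroup E] [NormedSpace 𝕜 E]
    [NormedAddCommGroup F] [NormedSpace 𝕜 F] (i : X →ₗᵢ[𝕜] E) (j : Y →ₗᵢ[𝕜] F)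
    (T : X →L[𝕜] Y →L[𝕜] 𝕜) {C : ℝ} (B : ℕ → E →L[𝕜] F →L[𝕜] 𝕜)
    (hC : ∀ n e f, ‖B n e f‖ ≤ C * ‖e‖ * ‖f‖)
    (hB : ∀ x y, Tendsto (fun n => B n (i x) (j y)) atTop (𝓝 (T x y))) :
    ∃ B' : E →L[𝕜] F →L[𝕜] 𝕜, ∀ x y, B' (i x) (j y) = T x y := by
  have hU : (hyperfilter ℕ : Filter ℕ) ≤ atTop := by
    rw [← Nat.cofinite_eq_atTop]; exact hyperfilter_le_cofinite
  have hlim : ∀ e f, ∃ z, Tendsto (fun n => B n e f) (hyperfilter ℕ) (𝓝 z) ∧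
      ‖z‖ ≤ C * ‖e‖ * ‖f‖ := by
    intro e f
    obtain ⟨z, hz, hle⟩ := (isCompact_closedBall (0 : 𝕜) (C * ‖e‖ * ‖f‖)).ultrafilter_le_nhds
      ((hyperfilter ℕ).map fun n => B n e f) (by
        rw [le_principal_iff]
        exact Eventually.of_forall (f := (hyperfilter ℕ : Filter ℕ))
          fun n => mem_closedBall_zero_iff.2 (hC n e f))
    exact ⟨z, hle, mem_closedBall_zero_iff.1 hz⟩
  choose L hL hLC using hlim
  refine ⟨(LinearMap.mk₂ 𝕜 L ?_ ?_ ?_ ?_).mkContinuous₂ C hLC, fun x y => ?_⟩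
  · intro e e' f
    refine tendsto_nhds_unique (hL (e + e') f) ?_
    simpa using (hL e f).add (hL e' f)
  · intro c e f
    refine tendsto_nhds_unique (hL (c • e) f) ?_
    simpa using (hL e f).const_mul c
  · intro e f f'
    refine tendsto_nhds_unique (hL e (f + f')) ?_
    simpa using (hL e f).add (hL e f')
  · intro c e f
    refine tendsto_nhds_unique (hL e (c • f)) ?_
    simpa using (hL e f).const_mul c
  · exact tendsto_nhds_unique (hL (i x) (j y)) ((hB x y).mono_left hU)

/-- A linear combination of products of functionals, with uniformly bounded extensions. -/
theorem exists_extension_finite_sum {E F : Type*} [NormedAddCommGroup E] [NormedSpace 𝕜 E]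
    [NormedAddCommGroup F] [NormedSpace 𝕜 F] (i : X →ₗᵢ[𝕜] E) (j : Y →ₗᵢ[𝕜] F)
    {ι : Type*} [Fintype ι] (c : ι → 𝕜) (f : ι → X →L[𝕜] 𝕜) (g : ι → Y →L[𝕜] 𝕜) {a b C : ℝ}
    (hf : ∀ k, ‖f k‖ ≤ a) (hg : ∀ k, ‖g k‖ ≤ b) (hC : ∑ k, ‖c k‖ ≤ C) (ha : 0 ≤ a)
    (hb : 0 ≤ b) :
    ∃ B : E →L[𝕜] F →L[𝕜] 𝕜, (∀ x y, B (i x) (j y) = ∑ k, c k * (f k x * g k y)) ∧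
      ∀ e f, ‖B e f‖ ≤ C * (a * b) * ‖e‖ * ‖f‖ := by
  choose f' hf' hfn using fun k => exists_dual_extension i (f k)
  choose g' hg' hgn using fun k => exists_dual_extension j (g k)
  refine ⟨∑ k, c k • (f' k).smulRight (g' k), fun x y => ?_, fun e h => ?_⟩
  · simp [hf', hg']
  · simp only [sum_apply, smul_apply,
      ContinuousLinearMap.smulRight_apply, smul_eq_mul]
    refine (norm_sum_le _ _).trans ?_
    have : C * (a * b) * ‖e‖ * ‖h‖ = C * (a * ‖e‖ * (b * ‖h‖)) := by ring
    rw [this]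
    refine le_trans ?_ (mul_le_mul_of_nonneg_right hC (by positivity))
    rw [Finset.sum_mul]
    refine Finset.sum_le_sum fun k _ => ?_
    rw [norm_mul, norm_mul]
    gcongr
    · exact (f' k).le_of_opNorm_le ((hfn k).trans (hf k)) e
    · exact (g' k).le_of_opNorm_le ((hgn k).trans (hg k)) h

end extendible

/-! ### Finitely supported sequences -/

namespace BanachSeqSpace

section finitelySupported

variable {𝕜 : Type u} [RCLike 𝕜] (X : BanachSeqSpace 𝕜)

variable {X} in
theorem ext_apply {x y : X} (h : ∀ n, x n = y n) : x = y := Subtype.ext (funext h)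

variable {X} in
theorem norm_le_norm_of_le {x y : X} (h : ∀ n, ‖x n‖ ≤ ‖y n‖) : ‖x‖ ≤ ‖y‖ :=
  (X.solid x.1 y h).2

/-- The `n`-th coordinate functional. -/
noncomputable def coord (n : ℕ) : X →L[𝕜] 𝕜 :=
  LinearMap.mkContinuous
    { toFun := fun x => x n
      map_add' := fun _ _ => rfl
      map_smul' := fun _ _ => rfl } 1 fun x => (X.norm_apply_le x n).trans_eq (one_mul _).symm

@[simp]
theorem coord_apply (n : ℕ) (x : X) : X.coord n x = x n := rfl

theorem norm_coord_le (n : ℕ) : ‖X.coord n‖ ≤ 1 :=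
  LinearMap.mkContinuous_norm_le _ zero_le_one _

theorem coe_sum_apply {ι : Type*} (s : Finset ι) (x : ι → X) (n : ℕ) :
    (∑ i ∈ s, x i : X) n = ∑ i ∈ s, x i n := by
  exact map_sum (X.coord n) x s

/-- The section `(a₀, …, a_{n-1}, 0, 0, …)` of the sequence `a`, an element of `X`. -/
def trunc (n : ℕ) (a : ℕ → 𝕜) : X :=
  ⟨fun k => if k < n then a k else 0, (X.ell_one_le _ (summable_of_hasFiniteSupport
    ((Set.finite_lt_nat n).subset fun k hk => by
      by_contra h
      exact hk (by simp only [Set.mem_ofPred_eq] at h; simp [h])))).1⟩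

variable {X} in
theorem trunc_apply (n : ℕ) (a : ℕ → 𝕜) (k : ℕ) :
    X.trunc n a k = if k < n then a k else 0 := rfl

/-- The unit vector `e_i`. -/
def unitVec (i : ℕ) : X := X.trunc (i + 1) (Pi.single i 1)

variable {X} in
theorem unitVec_apply (i k : ℕ) : X.unitVec i k = if k = i then 1 else 0 := by
  rw [unitVec, trunc_apply]
  by_cases h : k = i
  · simp [h]
  · simp [h]

theorem trunc_eq_sum (n : ℕ) (a : ℕ → 𝕜) :
    X.trunc n a = ∑ i ∈ Finset.range n, a i • X.unitVec i := by
  refine ext_apply fun k => ?_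
  rw [coe_sum_apply]
  have : ∀ i, (a i • X.unitVec i : X) k = a i * X.unitVec i k := fun _ => rfl
  simp [this, unitVec_apply, trunc_apply]

theorem trunc_const (n : ℕ) (c : 𝕜) :
    X.trunc n (fun _ => c) = c • X.trunc n (fun _ => 1) := by
  refine ext_apply fun k => ?_
  have : (c • X.trunc n (fun _ => 1) : X) k = c * X.trunc n (fun _ => 1) k := rfl
  simp [this, trunc_apply]

theorem norm_trunc_mono {n : ℕ} {a b : ℕ → 𝕜} (h : ∀ k < n, ‖a k‖ ≤ ‖b k‖) :
    ‖X.trunc n a‖ ≤ ‖X.trunc n b‖ := by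
  refine norm_le_norm_of_le fun k => ?_
  simp only [trunc_apply]
  split_ifs with hk
  · exact h k hk
  · simp

theorem norm_trunc_le (n : ℕ) (x : X) : ‖X.trunc n x‖ ≤ ‖x‖ := by
  refine norm_le_norm_of_le fun k => ?_
  simp only [trunc_apply]
  split_ifs <;> simp

theorem norm_unitVec (i : ℕ) : ‖X.unitVec i‖ = 1 := by
  apply le_antisymm
  · have h : (X.unitVec i : ℕ → 𝕜) = fun k => if k = i then 1 else 0 :=
      funext fun k => unitVec_apply i k
    have hs : HasSum (fun k => ‖(X.unitVec i : ℕ → 𝕜) k‖) 1 := by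
      rw [h]
      have e : ∀ k, ‖(if k = i then 1 else 0 : 𝕜)‖ = if k = i then 1 else 0 := by
        intro k; split_ifs <;> simp
      simp only [e]
      exact hasSum_ite_eq i 1
    exact (X.ell_one_le _ hs.summable).2.trans_eq hs.tsum_eq
  · have : ‖X.unitVec i i‖ ≤ ‖X.unitVec i‖ := X.norm_apply_le (X.unitVec i) i
    simpa [unitVec_apply] using this

/-- The fundamental function `φ(n) = ‖e_0 + ⋯ + e_{n-1}‖` of `X`. -/
noncomputable def fundamental (n : ℕ) : ℝ := ‖X.trunc n (fun _ => (1 : 𝕜))‖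

theorem norm_trunc_const (n : ℕ) (c : 𝕜) :
    ‖X.trunc n (fun _ => c)‖ = ‖c‖ * X.fundamental n := by
  rw [trunc_const, norm_smul, fundamental]

theorem one_le_fundamental {n : ℕ} (hn : 0 < n) : 1 ≤ X.fundamental n := by
  have : ‖X.trunc n (fun _ => (1 : 𝕜)) 0‖ ≤ X.fundamental n :=
    X.norm_apply_le (X.trunc n (fun _ => (1 : 𝕜))) 0
  simpa [trunc_apply, hn] using this

theorem fundamental_nonneg (n : ℕ) : 0 ≤ X.fundamental n := norm_nonneg _

theorem norm_trunc_le_sum (n : ℕ) (a : ℕ → 𝕜) :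
    ‖X.trunc n a‖ ≤ ∑ i ∈ Finset.range n, ‖a i‖ := by
  rw [trunc_eq_sum]
  refine norm_sum_le_of_le _ fun i _ => ?_
  rw [norm_smul, norm_unitVec, mul_one]

theorem fundamental_le (n : ℕ) : X.fundamental n ≤ n := by
  simpa [fundamental] using X.norm_trunc_le_sum n (fun _ => 1)

/-- The `ℓ₂`-norm of `(a₀, …, a_{n-1})`. -/
noncomputable def twoNorm (n : ℕ) (a : ℕ → 𝕜) : ℝ :=
  Real.sqrt (∑ k ∈ Finset.range n, ‖a k‖ ^ 2)

theorem twoNorm_nonneg (n : ℕ) (a : ℕ → 𝕜) : 0 ≤ twoNorm n a := Real.sqrt_nonneg _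

theorem sq_twoNorm (n : ℕ) (a : ℕ → 𝕜) :
    twoNorm n a ^ 2 = ∑ k ∈ Finset.range n, ‖a k‖ ^ 2 :=
  Real.sq_sqrt (Finset.sum_nonneg fun _ _ => by positivity)

theorem sum_mul_le_twoNorm (n : ℕ) (a b : ℕ → 𝕜) :
    ∑ k ∈ Finset.range n, ‖a k‖ * ‖b k‖ ≤ twoNorm n a * twoNorm n b :=
  Real.sum_mul_le_sqrt_mul_sqrt _ _ _

variable {X}

theorem sqrtSumSq_apply {N : ℕ} (x : Fin N → X) (k : ℕ) :
    X.sqrtSumSq x k = ((Real.sqrt (∑ j, ‖x j k‖ ^ 2) : ℝ) : 𝕜) := rfl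

/-! ### Averaging over cyclic shifts -/

/-- The `n` cyclic shifts of a section have the same norm, and at each of the first `n`
coordinates they take the values `a₀, …, a_{n-1}` in some order. -/
theorem IsSymmetric.exists_cyclic_shifts (hX : X.IsSymmetric) (n : ℕ) (a : ℕ → 𝕜) :
    ∃ y : Fin n → X, (∀ j, ‖y j‖ = ‖X.trunc n a‖) ∧ (∀ k, n ≤ k → ∀ j, y j k = 0) ∧
      ∀ k < n, ∀ g : 𝕜 → ℝ, ∑ j, g (y j k) = ∑ i ∈ Finset.range n, g (a i) := by
  rcases Nat.eq_zero_or_pos n with rfl | hn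
  · exact ⟨fun j => j.elim0, fun j => j.elim0, fun _ _ j => j.elim0, fun k hk => by omega⟩
  have : NeZero n := ⟨hn.ne'⟩
  set σ : Fin n → Equiv.Perm ℕ := fun j =>
    (Equiv.addRight j).extendDomain (Fin.equivSubtype (n := n)) with hσ
  have hσ1 : ∀ (j : Fin n) (k : ℕ) (hk : k < n), σ j k = ((⟨k, hk⟩ + j : Fin n) : ℕ) := by
    intro j k hk
    simp only [hσ]
    exact Equiv.Perm.extendDomain_apply_subtype (Equiv.addRight j) Fin.equivSubtype hk
  have hσ2 : ∀ (j : Fin n) (k : ℕ), n ≤ k → σ j k = k := by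
    intro j k hk
    simp only [hσ]
    exact Equiv.Perm.extendDomain_apply_not_subtype _ _ (by omega)
  choose y hy hyn using fun j => hX (σ j) (X.trunc n a)
  refine ⟨y, hyn, fun k hk j => ?_, fun k hk g => ?_⟩
  · rw [hy, hσ2 j k hk, trunc_apply, if_neg (by omega)]
  · have : ∀ j, y j k = a ((⟨k, hk⟩ + j : Fin n) : ℕ) := by
      intro j
      rw [hy, hσ1 j k hk, trunc_apply, if_pos (Fin.is_lt _)]
    simp only [this]
    rw [Finset.sum_range]
    exact Equiv.sum_comp (Equiv.addLeft (⟨k, hk⟩ : Fin n)) (fun i : Fin n => g (a i))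

theorem IsSymmetric.sqrtSumSq_cyclic_shifts (hX : X.IsSymmetric) (n : ℕ) (a : ℕ → 𝕜) :
    ∃ y : Fin n → X, ‖X.sqrtSumSq y‖ = twoNorm n a * X.fundamental n ∧
      Real.sqrt (∑ j, ‖y j‖ ^ 2) = Real.sqrt n * ‖X.trunc n a‖ := by
  obtain ⟨y, hn, h0, hs⟩ := hX.exists_cyclic_shifts n a
  refine ⟨y, ?_, ?_⟩
  · have : X.sqrtSumSq y = X.trunc n (fun _ => ((twoNorm n a : ℝ) : 𝕜)) := by
      refine ext_apply fun k => ?_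
      rw [sqrtSumSq_apply, trunc_apply]
      split_ifs with hk
      · rw [hs k hk (fun z => ‖z‖ ^ 2), twoNorm]
      · simp [h0 k (not_lt.1 hk)]
    rw [this, norm_trunc_const, RCLike.norm_ofReal, abs_of_nonneg (twoNorm_nonneg _ _)]
  · simp only [hn, Finset.sum_const, Finset.card_univ, Fintype.card_fin, nsmul_eq_mul]
    rw [Real.sqrt_mul (Nat.cast_nonneg _), Real.sqrt_sq (norm_nonneg _)]

/-- In a symmetric space the average of the cyclic shifts of `|x|` is constant on the section,
whence `‖x‖₁ φ(n) ≤ n ‖x‖`. -/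
theorem IsSymmetric.sum_mul_fundamental_le (hX : X.IsSymmetric) (n : ℕ) (x : X) :
    (∑ k ∈ Finset.range n, ‖x k‖) * X.fundamental n ≤ n * ‖x‖ := by
  set a : ℕ → 𝕜 := fun k => ((‖x k‖ : ℝ) : 𝕜) with ha
  obtain ⟨y, hn, h0, hs⟩ := hX.exists_cyclic_shifts n a
  have hnorm : ‖X.trunc n a‖ ≤ ‖x‖ := by
    refine le_trans ?_ (X.norm_trunc_le n x)
    exact X.norm_trunc_mono fun k _ => by simp [ha]
  have hy : ∀ j k, y j k = ((RCLike.re (y j k) : ℝ) : 𝕜) ∨ n ≤ k := by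
    intro j k
    by_cases hk : k < n
    · left
      -- the sum over `j` of the squared imaginary parts vanishes
      have h1 := hs k hk (fun z => RCLike.im z ^ 2)
      simp only [ha, RCLike.ofReal_im] at h1
      have h2 := (Finset.sum_eq_zero_iff_of_nonneg fun i _ => sq_nonneg _).1
        (h1.trans (by simp)) j (Finset.mem_univ j)
      exact (RCLike.ext (by simp) (by simpa using h2))
    · right; omega
  have e : (∑ j, y j : X) = X.trunc n (fun _ => ((∑ k ∈ Finset.range n, ‖x k‖ : ℝ) : 𝕜)) := by
    refine ext_apply fun k => ?_
    rw [coe_sum_apply, trunc_apply]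
    split_ifs with hk
    · have h1 := hs k hk RCLike.re
      simp only [ha, RCLike.ofReal_re] at h1
      rw [← h1, RCLike.ofReal_sum]
      exact Finset.sum_congr rfl fun j _ => (hy j k).resolve_right (by omega)
    · exact Finset.sum_eq_zero fun j _ => h0 k (not_lt.1 hk) j
  have h1 : ‖(∑ j, y j : X)‖ ≤ n * ‖x‖ := by
    refine (norm_sum_le_of_le _ fun j _ => (hn j).trans_le hnorm).trans_eq ?_
    simp
  rw [e, norm_trunc_const, RCLike.norm_ofReal,
    abs_of_nonneg (Finset.sum_nonneg fun _ _ => norm_nonneg _)] at h1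
  exact h1

theorem sqrtSumSq_unitVec (n : ℕ) (a : ℕ → 𝕜) :
    ‖X.sqrtSumSq (fun i : Fin n => (a i • X.unitVec i : X))‖ = ‖X.trunc n a‖ ∧
      Real.sqrt (∑ i : Fin n, ‖(a i • X.unitVec i : X)‖ ^ 2) = twoNorm n a := by
  constructor
  · have : ∀ k, ‖X.sqrtSumSq (fun i : Fin n => (a i • X.unitVec i : X)) k‖ =
        ‖X.trunc n a k‖ := by
      intro k
      rw [sqrtSumSq_apply, RCLike.norm_ofReal, abs_of_nonneg (Real.sqrt_nonneg _)]
      have h1 : ∀ i : Fin n, (a i • X.unitVec i : X) k = a i * X.unitVec i k := fun _ => rfl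
      simp only [h1]
      rw [← Finset.sum_range (fun i => ‖a i * X.unitVec i k‖ ^ 2)]
      have h2 : ∀ i, ‖a i * X.unitVec i k‖ ^ 2 = if k = i then ‖a i‖ ^ 2 else 0 := by
        intro i
        rw [unitVec_apply]
        split_ifs <;> simp
      simp only [h2, Finset.sum_ite_eq, Finset.mem_range, trunc_apply]
      split_ifs <;> simp
    exact le_antisymm (norm_le_norm_of_le fun k => (this k).le)
      (norm_le_norm_of_le fun k => (this k).ge)
  · simp only [norm_smul, norm_unitVec, mul_one, twoNorm]
    rw [Finset.sum_range]

/-- A symmetric `2`-convex space satisfies an upper `ℓ₂`-estimate and, by averaging, a lower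
estimate of its norm by its fundamental function. -/
theorem IsTwoConvex.estimates (h : X.IsTwoConvex) (hX : X.IsSymmetric) :
    ∃ κ : ℝ, 0 < κ ∧ (∀ n a, ‖X.trunc n a‖ ≤ κ * twoNorm n a) ∧
      ∀ n (x : X), twoNorm n x * X.fundamental n ≤ κ * Real.sqrt n * ‖x‖ := by
  obtain ⟨κ, hκ, h⟩ := h
  refine ⟨κ, hκ, fun n a => ?_, fun n x => ?_⟩
  · have := h n fun i => a i • X.unitVec i
    rwa [(sqrtSumSq_unitVec n a).1, (sqrtSumSq_unitVec n a).2] at this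
  · obtain ⟨y, h1, h2⟩ := hX.sqrtSumSq_cyclic_shifts n x
    have := h n y
    rw [h1, h2, ← mul_assoc] at this
    exact this.trans (mul_le_mul_of_nonneg_left (X.norm_trunc_le n x) (by positivity))

/-- A symmetric `2`-concave space satisfies a lower `ℓ₂`-estimate and, by averaging, an upper
estimate of its norm by its fundamental function. -/
theorem IsTwoConcave.estimates (h : X.IsTwoConcave) (hX : X.IsSymmetric) :
    ∃ κ : ℝ, 0 < κ ∧ (∀ n (x : X), twoNorm n x ≤ κ * ‖x‖) ∧
      ∀ (n : ℕ) a, Real.sqrt n * ‖X.trunc n a‖ ≤ κ * (twoNorm n a * X.fundamental n) := by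
  obtain ⟨κ, hκ, h⟩ := h
  refine ⟨κ, hκ, fun n x => ?_, fun n a => ?_⟩
  · have := h n fun i => x i • X.unitVec i
    rw [(sqrtSumSq_unitVec n x).1, (sqrtSumSq_unitVec n x).2] at this
    exact this.trans (mul_le_mul_of_nonneg_left (X.norm_trunc_le n x) hκ.le)
  · obtain ⟨y, h1, h2⟩ := hX.sqrtSumSq_cyclic_shifts n a
    have := h n y
    rwa [h1, h2] at this

end finitelySupported

end BanachSeqSpace

/-! ### Diagonal forms -/

namespace BanachSeqSpace

section diagonal

variable {𝕜 : Type u} [RCLike 𝕜] {X Y : BanachSeqSpace 𝕜}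

theorem apply_trunc_trunc_of_tendsto {T : X →L[𝕜] Y →L[𝕜] 𝕜} {α : ℕ → 𝕜}
    (h : ∀ (x : X) (y : Y),
      Tendsto (fun n => ∑ k ∈ Finset.range n, α k * x k * y k) atTop (𝓝 (T x y)))
    (N : ℕ) (a b : ℕ → 𝕜) :
    T (X.trunc N a) (Y.trunc N b) = ∑ k ∈ Finset.range N, α k * a k * b k := by
  refine tendsto_nhds_unique (h _ _) (tendsto_const_nhds.congr' ?_)
  filter_upwards [eventually_ge_atTop N] with n hn
  rw [← Finset.sum_subset (Finset.range_mono hn)]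
  · refine Finset.sum_congr rfl fun k hk => ?_
    simp [trunc_apply, Finset.mem_range.1 hk]
  · intro k _ hk
    simp [trunc_apply, Finset.mem_range.not.1 hk]

theorem apply_unitVec_unitVec_of_tendsto {T : X →L[𝕜] Y →L[𝕜] 𝕜} {α : ℕ → 𝕜}
    (h : ∀ (x : X) (y : Y),
      Tendsto (fun n => ∑ k ∈ Finset.range n, α k * x k * y k) atTop (𝓝 (T x y)))
    (i : ℕ) : T (X.unitVec i) (Y.unitVec i) = α i := by
  rw [unitVec, unitVec, apply_trunc_trunc_of_tendsto h, Finset.sum_eq_single i]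
  · simp
  · intro k _ hk
    simp [hk]
  · simp

/-- A sequence with uniformly bounded sections as multiplier defines a diagonal form. -/
theorem exists_isDiagonal (α : ℕ → 𝕜) {C : ℝ}
    (h : ∀ (x : X) (y : Y) (N : ℕ),
      ∑ k ∈ Finset.range N, ‖α k‖ * (‖x k‖ * ‖y k‖) ≤ C * ‖x‖ * ‖y‖) :
    ∃ T : X →L[𝕜] Y →L[𝕜] 𝕜, IsDiagonal T ∧ ∀ i, T (X.unitVec i) (Y.unitVec i) = α i := by
  have hn : ∀ (x : X) (y : Y) k, ‖α k * x k * y k‖ = ‖α k‖ * (‖x k‖ * ‖y k‖) := by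
    intro x y k; rw [norm_mul, norm_mul, mul_assoc]
  have hs : ∀ (x : X) (y : Y), Summable fun k => ‖α k * x k * y k‖ := by
    intro x y
    refine summable_of_sum_range_le (c := C * ‖x‖ * ‖y‖) (fun _ => norm_nonneg _) fun N => ?_
    simp only [hn]
    exact h x y N
  have hS : ∀ (x : X) (y : Y), HasSum (fun k => α k * x k * y k) (∑' k, α k * x k * y k) :=
    fun x y => (hs x y).of_norm.hasSum
  set T : X →L[𝕜] Y →L[𝕜] 𝕜 := (LinearMap.mk₂ 𝕜
    (fun (x : X) (y : Y) => ∑' k, α k * x k * y k)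
    (by
      intro x x' y
      rw [← ((hS x y).add (hS x' y)).tsum_eq]
      refine tsum_congr fun k => ?_
      change α k * (x k + x' k) * y k = _
      ring)
    (by
      intro c x y
      rw [smul_eq_mul, ← ((hS x y).mul_left c).tsum_eq]
      refine tsum_congr fun k => ?_
      change α k * (c * x k) * y k = _
      ring)
    (by
      intro x y y'
      rw [← ((hS x y).add (hS x y')).tsum_eq]
      refine tsum_congr fun k => ?_
      change α k * x k * (y k + y' k) = _
      ring)
    (by
      intro c x y
      rw [smul_eq_mul, ← ((hS x y).mul_left c).tsum_eq]
      refine tsum_congr fun k => ?_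
      change α k * x k * (c * y k) = _
      ring)).mkContinuous₂ C (by
      intro x y
      refine (norm_tsum_le_tsum_norm (hs x y)).trans ?_
      refine (hs x y).tsum_le_of_sum_range_le fun N => ?_
      simp only [hn]
      exact h x y N)
  have hT : ∀ (x : X) (y : Y),
      Tendsto (fun n => ∑ k ∈ Finset.range n, α k * x k * y k) atTop (𝓝 (T x y)) :=
    fun x y => (hS x y).tendsto_sum_nat
  exact ⟨T, ⟨α, hT⟩, apply_unitVec_unitVec_of_tendsto hT⟩

/-- An upper `ℓ₂`-estimate bounds the weak `ℓ₂`-norm of the unit vectors. -/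
theorem sum_norm_apply_unitVec_sq_le {n : ℕ} {p : ℝ} (hp : 0 < p)
    (h : ∀ a, ‖X.trunc n a‖ ≤ p * twoNorm n a) (f : X →L[𝕜] 𝕜) (hf : ‖f‖ ≤ 1) :
    ∑ i : Fin n, ‖f (X.unitVec i)‖ ^ 2 ≤ p ^ 2 := by
  set a : ℕ → 𝕜 := fun i => starRingEnd 𝕜 (f (X.unitVec i)) with ha
  have h1 : f (X.trunc n a) = ((twoNorm n a ^ 2 : ℝ) : 𝕜) := by
    rw [trunc_eq_sum, map_sum, sq_twoNorm, RCLike.ofReal_sum]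
    refine Finset.sum_congr rfl fun i _ => ?_
    simp only [ha, map_smul, smul_eq_mul, RCLike.norm_conj]
    rw [RCLike.conj_mul]
    push_cast
    rfl
  have h2 : twoNorm n a ^ 2 ≤ p * twoNorm n a := by
    have := (f.le_of_opNorm_le hf (X.trunc n a)).trans ((one_mul _).trans_le (h a))
    rwa [h1, RCLike.norm_ofReal, abs_of_nonneg (by positivity)] at this
  have h3 : twoNorm n a ≤ p := by
    rcases (twoNorm_nonneg n a).eq_or_lt with h0 | h0
    · rw [← h0]; exact hp.le
    · exact le_of_mul_le_mul_right (by rwa [← sq]) h0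
  have h4 : ∑ i : Fin n, ‖f (X.unitVec i)‖ ^ 2 = twoNorm n a ^ 2 := by
    rw [sq_twoNorm, Finset.sum_range]
    simp [ha]
  rw [h4]
  exact pow_le_pow_left₀ (twoNorm_nonneg n a) h3 2

/-- The quantitative consequence of the extendibility of all diagonal forms. Here `M n` bounds the
norm of the `n`-th section of the diagonal form `∑ xₖ yₖ`, and `p n`, `q n` bound the weak
`ℓ₂`-norms of the first `n` unit vectors of `X` and `Y`. If the conclusion fails, a rapidly
convergent series of normalized sections is a diagonal form that is not extendible. -/
theorem exists_le_of_forall_isExtendible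
    (hext : ∀ T : X →L[𝕜] Y →L[𝕜] 𝕜, IsDiagonal T → IsExtendible T) (M p q : ℕ → ℝ)
    (hM : ∀ n, 0 < n → 0 < M n) (hp : ∀ n, 0 < n → 0 < p n) (hq : ∀ n, 0 < n → 0 < q n)
    (hXY : ∀ n, 0 < n → ∀ (x : X) (y : Y),
      ∑ k ∈ Finset.range n, ‖x k‖ * ‖y k‖ ≤ M n * ‖x‖ * ‖y‖)
    (hX : ∀ n, 0 < n → ∀ a, ‖X.trunc n a‖ ≤ p n * twoNorm n a)
    (hY : ∀ n, 0 < n → ∀ a, ‖Y.trunc n a‖ ≤ q n * twoNorm n a) :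
    ∃ D : ℝ, ∀ n : ℕ, 0 < n → (n : ℝ) ≤ D * (M n * (p n * q n)) := by
  by_contra! hD
  choose n hn0 hn using fun j : ℕ => hD (4 ^ j)
  set c : ℕ → ℝ := fun j => (1 / 2) ^ j / M (n j) with hc
  have hc0 : ∀ j, 0 < c j := fun j => div_pos (by positivity) (hM _ (hn0 j))
  -- testing on `e₀` shows that `1 ≤ M n`, so that `c` is summable
  have hM1 : ∀ j, 1 ≤ M (n j) := by
    intro j
    have h1 := hXY (n j) (hn0 j) (X.unitVec 0) (Y.unitVec 0)
    rw [norm_unitVec, norm_unitVec, mul_one, mul_one] at h1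
    refine le_trans ?_ h1
    refine le_trans ?_ (Finset.single_le_sum
      (f := fun k => ‖X.unitVec 0 k‖ * ‖Y.unitVec 0 k‖) (fun k _ => by positivity)
      (Finset.mem_range.2 (hn0 j)))
    simp [unitVec_apply]
  have hcs : ∀ k, Summable fun j => if k < n j then c j else 0 := by
    intro k
    refine Summable.of_nonneg_of_le (fun j => ?_) (fun j => ?_) summable_geometric_two
    · split_ifs
      exacts [(hc0 j).le, le_rfl]
    · split_ifs
      · exact div_le_self (by positivity) (hM1 j)
      · positivity
  set α : ℕ → ℝ := fun k => ∑' j, if k < n j then c j else 0 with hα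
  have hα0 : ∀ k, 0 ≤ α k := fun k => tsum_nonneg fun j => by
    split_ifs
    exacts [(hc0 j).le, le_rfl]
  have hαc : ∀ k j, k < n j → c j ≤ α k := by
    intro k j hk
    have := (hcs k).le_tsum j (fun i _ => by
      split_ifs
      exacts [(hc0 i).le, le_rfl])
    simpa only [if_pos hk] using this
  obtain ⟨T, hT, hTα⟩ := exists_isDiagonal (X := X) (Y := Y) (fun k => (α k : 𝕜)) (C := 2) (by
    intro x y N
    have e : ∀ k, ‖(α k : 𝕜)‖ * (‖x k‖ * ‖y k‖) =
        ∑' j, (if k < n j then c j else 0) * (‖x k‖ * ‖y k‖) := by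
      intro k
      rw [RCLike.norm_ofReal, abs_of_nonneg (hα0 k), ← tsum_mul_right]
    simp only [e]
    rw [← Summable.tsum_finsetSum fun k _ => (hcs k).mul_right _]
    have hb : ∀ j, ∑ k ∈ Finset.range N, (if k < n j then c j else 0) * (‖x k‖ * ‖y k‖) ≤
        (1 / 2) ^ j * (‖x‖ * ‖y‖) := by
      intro j
      calc ∑ k ∈ Finset.range N, (if k < n j then c j else 0) * (‖x k‖ * ‖y k‖)
          = ∑ k ∈ Finset.range N with k < n j, c j * (‖x k‖ * ‖y k‖) := by
            rw [Finset.sum_filter]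
            exact Finset.sum_congr rfl fun k _ => by split_ifs <;> simp
        _ ≤ ∑ k ∈ Finset.range (n j), c j * (‖x k‖ * ‖y k‖) := by
            refine Finset.sum_le_sum_of_subset_of_nonneg (fun k hk => ?_) fun k _ _ => ?_
            · exact Finset.mem_range.2 (Finset.mem_filter.1 hk).2
            · have := hc0 j; positivity
        _ ≤ c j * (M (n j) * ‖x‖ * ‖y‖) := by
            rw [← Finset.mul_sum]
            exact mul_le_mul_of_nonneg_left (hXY _ (hn0 j) x y) (hc0 j).le
        _ = (1 / 2) ^ j * (‖x‖ * ‖y‖) := by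
            have := (hM _ (hn0 j)).ne'
            simp only [hc]
            field_simp
    refine (Summable.tsum_le_tsum hb (summable_sum fun k _ => (hcs k).mul_right _)
      (summable_geometric_two.mul_right _)).trans_eq ?_
    rw [tsum_mul_right, tsum_geometric_two, mul_assoc])
  obtain ⟨L, hL⟩ := (hext T hT).exists_bound
  have key : ∀ j, (2 : ℝ) ^ j < L := by
    intro j
    have h1 := hL (n j) (fun i => X.unitVec i) (fun i => Y.unitVec i) (p (n j)) (q (n j))
      (hp _ (hn0 j)) (hq _ (hn0 j))
      (fun f hf => sum_norm_apply_unitVec_sq_le (hp _ (hn0 j)) (hX _ (hn0 j)) f hf)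
      (fun f hf => sum_norm_apply_unitVec_sq_le (hq _ (hn0 j)) (hY _ (hn0 j)) f hf)
    simp only [hTα] at h1
    rw [← RCLike.ofReal_sum, RCLike.norm_ofReal] at h1
    have h2 : n j * c j ≤ ∑ i : Fin (n j), α i := by
      have := Finset.card_nsmul_le_sum Finset.univ (fun i : Fin (n j) => α i) (c j)
        fun i _ => hαc i j i.2
      simpa using this
    have h3 := hn j
    have hMj := hM _ (hn0 j)
    have hpq := mul_pos (hp _ (hn0 j)) (hq _ (hn0 j))
    set P := p (n j) * q (n j)
    have h5 : 4 ^ j * (M (n j) * P) * c j < L * P :=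
      (mul_lt_mul_of_pos_right h3 (hc0 j)).trans_le (h2.trans ((le_abs_self _).trans h1))
    have h6 : 4 ^ j * (M (n j) * P) * c j = 2 ^ j * P := by
      have : (4 : ℝ) ^ j = 2 ^ j * 2 ^ j := by rw [← mul_pow]; norm_num
      simp only [hc, this]
      field_simp
      rw [← mul_pow]
      norm_num
    rw [h6] at h5
    exact lt_of_mul_lt_mul_right h5 hpq.le
  obtain ⟨j, hj⟩ := pow_unbounded_of_one_lt L (one_lt_two)
  exact lt_asymm hj (key j)

end diagonal

end BanachSeqSpace

/-! ### Recognizing `ℓ₁`, `c₀` and `ℓ_∞` -/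

namespace BanachSeqSpace

section recognition

variable {𝕜 : Type u} [RCLike 𝕜] {X Y : BanachSeqSpace 𝕜}

theorem norm_trunc_le_of_fundamental_le {C : ℝ} (hC : ∀ n, X.fundamental n ≤ C) {A : ℝ}
    (n : ℕ) {a : ℕ → 𝕜} (hA0 : 0 ≤ A) (hA : ∀ k, ‖a k‖ ≤ A) : ‖X.trunc n a‖ ≤ C * A := by
  have h := X.norm_trunc_mono (n := n) (a := a) (b := fun _ => (A : 𝕜)) fun k _ => by
    rw [RCLike.norm_ofReal]
    exact (hA k).trans (le_abs_self A)
  rw [norm_trunc_const, RCLike.norm_ofReal, abs_of_nonneg hA0] at h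
  nlinarith [hC n]

/-- If the fundamental function is bounded, then `c₀ ⊆ X` continuously. -/
theorem exists_mem_of_tendsto_zero {C : ℝ} (hC : ∀ n, X.fundamental n ≤ C) {x : ℕ → 𝕜}
    (hx : Tendsto x atTop (𝓝 0)) :
    ∃ y : X, (∀ k, y k = x k) ∧ ∀ A, (∀ k, ‖x k‖ ≤ A) → ‖y‖ ≤ C * A := by
  have hC0 : 0 ≤ C := (X.fundamental_nonneg 0).trans (hC 0)
  have hcauchy : CauchySeq fun n => X.trunc n x := by
    rw [Metric.cauchySeq_iff']
    intro ε hε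
    obtain ⟨N, hN⟩ := Metric.tendsto_atTop.1 hx (ε / (C + 1)) (by positivity)
    refine ⟨N, fun n hn => ?_⟩
    have e : X.trunc n x - X.trunc N x = X.trunc n (fun k => if k < N then 0 else x k) := by
      refine ext_apply fun k => ?_
      change X.trunc n x k - X.trunc N x k = _
      simp only [trunc_apply]
      by_cases h1 : k < N
      · simp [h1, h1.trans_le hn]
      · simp [h1]
    rw [dist_eq_norm, e]
    refine (norm_trunc_le_of_fundamental_le hC n (A := ε / (C + 1)) (by positivity)
      fun k => ?_).trans_lt ?_
    · split_ifs with h1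
      · simp; positivity
      · have := hN k (not_lt.1 h1)
        rw [dist_zero_right] at this
        exact this.le
    · rw [mul_div_assoc', div_lt_iff₀ (by positivity)]
      nlinarith
  obtain ⟨y, hy⟩ := cauchySeq_tendsto_of_complete hcauchy
  refine ⟨y, fun k => ?_, fun A hA => ?_⟩
  · have h1 := ((X.coord k).continuous.tendsto y).comp hy
    refine tendsto_nhds_unique h1 (tendsto_const_nhds.congr' ?_)
    filter_upwards [eventually_gt_atTop k] with n hn
    simp [trunc_apply, hn]
  · exact le_of_tendsto hy.norm (Eventually.of_forall fun n =>
      norm_trunc_le_of_fundamental_le hC n ((norm_nonneg _).trans (hA 0)) hA)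

theorem bddAbove_range_norm (x : X) : BddAbove (Set.range fun n => ‖x n‖) :=
  ⟨‖x‖, by rintro _ ⟨n, rfl⟩; exact X.norm_apply_le x n⟩

theorem iSup_norm_apply_le (x : X) : ⨆ n, ‖x n‖ ≤ ‖x‖ := ciSup_le (X.norm_apply_le x)

theorem exists_perm_mem_iff_notMem {A : Set ℕ} (hA : A.Infinite) (hA' : Aᶜ.Infinite) :
    ∃ σ : Equiv.Perm ℕ, ∀ n, n ∈ A ↔ σ n ∉ A := by
  classical
  have := hA.to_subtype
  have := hA'.to_subtype
  obtain ⟨i1⟩ := nonempty_denumerable A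
  obtain ⟨i2⟩ := nonempty_denumerable (Aᶜ : Set ℕ)
  let e : A ≃ (Aᶜ : Set ℕ) := Denumerable.equiv₂ _ _
  refine ⟨(Equiv.Set.sumCompl A).symm.trans ((Equiv.sumComm _ _).trans
    ((Equiv.sumCongr e.symm e).trans (Equiv.Set.sumCompl A))), fun n => ?_⟩
  by_cases h : n ∈ A
  · simp only [h, Equiv.trans_apply, Equiv.Set.sumCompl_symm_apply_of_mem, true_iff]
    exact (e ⟨n, h⟩).2
  · simp [h, Equiv.Set.sumCompl_symm_apply_of_notMem]

/-- A symmetric space containing a sequence which does not tend to zero contains the indicator of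
an infinite and coinfinite set, hence that of its complement, hence the constant sequences. -/
theorem IsSymmetric.one_mem (hX : X.IsSymmetric) (x : X)
    (hx : ¬ Tendsto (x : ℕ → 𝕜) atTop (𝓝 0)) : (fun _ => 1) ∈ X.carrier := by
  classical
  rw [Metric.tendsto_atTop] at hx
  push Not at hx
  obtain ⟨ε, hε, h⟩ := hx
  simp only [dist_zero_right] at h
  have hinf : {n | ε ≤ ‖x n‖}.Infinite := Set.infinite_of_forall_exists_gt fun n => by
    obtain ⟨m, hm, hm'⟩ := h (n + 1)
    exact ⟨m, hm', by omega⟩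
  set f := hinf.natEmbedding
  -- half of the indices at which `x` is large
  set A : Set ℕ := Set.range fun k => (f (2 * k) : ℕ) with hA
  have hA1 : A.Infinite := Set.infinite_range_of_injective fun a b hab => by
    have := f.injective (Subtype.ext hab)
    omega
  have hA2 : Aᶜ.Infinite := by
    refine (Set.infinite_range_of_injective (f := fun k => (f (2 * k + 1) : ℕ))
      fun a b hab => ?_).mono ?_
    · have := f.injective (Subtype.ext hab)
      omega
    · rintro _ ⟨k, rfl⟩ ⟨l, hl⟩
      have := f.injective (Subtype.ext hl)
      omega
  have hAx : ∀ n ∈ A, ε ≤ ‖x n‖ := by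
    rintro _ ⟨k, rfl⟩
    exact (f (2 * k)).2
  have h1 : A.indicator (fun _ => (1 : 𝕜)) ∈ X.carrier := by
    refine (X.solid _ ((((1 / ε : ℝ) : 𝕜) • x : X)) fun n => ?_).1
    change _ ≤ ‖((1 / ε : ℝ) : 𝕜) * x n‖
    by_cases hn : n ∈ A
    · rw [Set.indicator_of_mem hn, norm_mul, RCLike.norm_ofReal, abs_of_pos (by positivity),
        norm_one, one_div, ← div_eq_inv_mul, one_le_div hε]
      exact hAx n hn
    · rw [Set.indicator_of_notMem hn, norm_zero]
      exact norm_nonneg _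
  obtain ⟨σ, hσ⟩ := exists_perm_mem_iff_notMem hA1 hA2
  obtain ⟨y, hy, -⟩ := hX σ ⟨_, h1⟩
  have h2 := X.carrier.add_mem h1 y.2
  convert h2 using 1
  funext n
  rw [Pi.add_apply, hy n]
  change 1 = A.indicator (fun _ => (1 : 𝕜)) n + A.indicator (fun _ => (1 : 𝕜)) (σ n)
  by_cases hn : n ∈ A
  · rw [Set.indicator_of_mem hn, Set.indicator_of_notMem ((hσ n).1 hn), add_zero]
  · rw [Set.indicator_of_notMem hn, Set.indicator_of_mem (not_not.1 ((hσ n).not.1 hn)), zero_add]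

/-- A symmetric space with bounded fundamental function is `c₀` or `ℓ_∞`. -/
theorem IsSymmetric.isCZero_or_isEllInfty (hX : X.IsSymmetric) {C : ℝ}
    (hC : ∀ n, X.fundamental n ≤ C) : X.IsCZero ∨ X.IsEllInfty := by
  by_cases h : ∀ x : X, Tendsto (x : ℕ → 𝕜) atTop (𝓝 0)
  · left
    refine ⟨Set.Subset.antisymm (fun x hx => h ⟨x, hx⟩) fun x hx => ?_, 1, C, one_pos,
      one_pos.trans_le ((X.one_le_fundamental one_pos).trans (hC 1)), fun x => ⟨?_, ?_⟩⟩
    · obtain ⟨y, hy, -⟩ := exists_mem_of_tendsto_zero hC hx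
      have : x = y := funext fun k => (hy k).symm
      rw [this]
      exact y.2
    · rw [one_mul]
      exact iSup_norm_apply_le x
    · obtain ⟨y, hy, hyA⟩ := exists_mem_of_tendsto_zero hC (h x)
      rw [← ext_apply hy]
      refine hyA _ fun k => ?_
      rw [← hy]
      exact le_ciSup (bddAbove_range_norm y) k
  · right
    push Not at h
    obtain ⟨x, hx⟩ := h
    set o : X := ⟨_, hX.one_mem x hx⟩
    have key : ∀ x : ℕ → 𝕜, BddAbove (Set.range fun n => ‖x n‖) →
        ∃ hx : x ∈ X.carrier, X.nrm ⟨x, hx⟩ ≤ ‖o‖ * ⨆ n, ‖x n‖ := by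
      intro x hx
      have h0 : 0 ≤ ⨆ n, ‖x n‖ := Real.iSup_nonneg fun _ => norm_nonneg _
      obtain ⟨h1, h2⟩ := X.solid x ((((⨆ n, ‖x n‖ : ℝ) : 𝕜) • o : X)) fun n => by
        change _ ≤ ‖((⨆ n, ‖x n‖ : ℝ) : 𝕜) * 1‖
        rw [mul_one, RCLike.norm_ofReal, abs_of_nonneg h0]
        exact le_ciSup hx n
      refine ⟨h1, h2.trans_eq ?_⟩
      change ‖(((⨆ n, ‖x n‖ : ℝ) : 𝕜) • o : X)‖ = _
      rw [norm_smul, RCLike.norm_ofReal, abs_of_nonneg h0, mul_comm]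
    have ho : 1 ≤ ‖o‖ := by
      have : ‖(1 : 𝕜)‖ ≤ ‖o‖ := X.norm_apply_le o 0
      simpa using this
    refine ⟨Set.Subset.antisymm (fun x hx => bddAbove_range_norm (X := X) ⟨x, hx⟩)
      fun x hx => (key x hx).1, 1, ‖o‖, one_pos, one_pos.trans_le ho, fun x => ⟨?_, ?_⟩⟩
    · rw [one_mul]
      exact iSup_norm_apply_le x
    · exact (key x (bddAbove_range_norm x)).2

theorem IsSymmetric.sum_norm_le (hX : X.IsSymmetric) {C : ℝ}
    (hC : ∀ n : ℕ, 0 < n → n ≤ C * X.fundamental n) (n : ℕ) (x : X) :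
    ∑ k ∈ Finset.range n, ‖x k‖ ≤ C * ‖x‖ := by
  have hC0 : 0 < C := by
    have h1 := hC 1 one_pos
    by_contra! h
    have := X.fundamental_nonneg 1
    push_cast at h1
    nlinarith
  rcases Nat.eq_zero_or_pos n with rfl | hn
  · simp; positivity
  have h1 := hX.sum_mul_fundamental_le n x
  have h2 := mul_le_mul_of_nonneg_right (hC n hn) (norm_nonneg x)
  have h3 : 0 < X.fundamental n := one_pos.trans_le (X.one_le_fundamental hn)
  refine le_of_mul_le_mul_right ?_ h3
  linarith

/-- A symmetric space whose fundamental function grows linearly is `ℓ₁`. -/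
theorem IsSymmetric.isEllOne (hX : X.IsSymmetric) {C : ℝ} (hC0 : 0 < C)
    (hC : ∀ n : ℕ, 0 < n → n ≤ C * X.fundamental n) : X.IsEllOne := by
  have hs : ∀ x : X, Summable fun n => ‖x n‖ := fun x =>
    summable_of_sum_range_le (fun _ => norm_nonneg _) fun n => hX.sum_norm_le hC n x
  refine ⟨Set.Subset.antisymm (fun x hx => hs ⟨x, hx⟩) fun x hx => (X.ell_one_le x hx).1,
    C⁻¹, 1, by positivity, one_pos, fun x => ⟨?_, ?_⟩⟩
  · rw [inv_mul_le_iff₀ hC0]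
    exact (hs x).tsum_le_of_sum_range_le fun n => hX.sum_norm_le hC n x
  · rw [one_mul]
    exact (X.ell_one_le x (hs x)).2

end recognition

/-! ### Necessity -/

section necessity

variable {𝕜 : Type u} [RCLike 𝕜] {X Y : BanachSeqSpace 𝕜}

theorem isExtendible_flip_of_forall
    (hext : ∀ T : X →L[𝕜] Y →L[𝕜] 𝕜, IsDiagonal T → IsExtendible T)
    (T : Y →L[𝕜] X →L[𝕜] 𝕜) (hT : IsDiagonal T) : IsExtendible T := by
  obtain ⟨α, hα⟩ := hT
  have h := hext T.flip ⟨α, fun x y => (hα y x).congr fun n =>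
    Finset.sum_congr rfl fun k _ => mul_right_comm _ _ _⟩
  intro E F _ _ _ _ _ _ i j
  obtain ⟨B, hB⟩ := h F E j i
  exact ⟨B.flip, fun x y => hB y x⟩

theorem fundamental_mul_fundamental_le_of_twoConvex (hX : X.IsSymmetric) (hY : Y.IsSymmetric)
    (hX2 : X.IsTwoConvex) (hY2 : Y.IsTwoConvex)
    (hext : ∀ T : X →L[𝕜] Y →L[𝕜] 𝕜, IsDiagonal T → IsExtendible T) :
    ∃ C : ℝ, ∀ n, 0 < n → X.fundamental n * Y.fundamental n ≤ C := by
  obtain ⟨κ, hκ, h1, h2⟩ := hX2.estimates hX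
  obtain ⟨μ, hμ, h3, h4⟩ := hY2.estimates hY
  have hf : ∀ n, 0 < n → 0 < X.fundamental n * Y.fundamental n := fun n hn =>
    mul_pos (one_pos.trans_le (X.one_le_fundamental hn))
      (one_pos.trans_le (Y.one_le_fundamental hn))
  obtain ⟨D, hD⟩ := exists_le_of_forall_isExtendible hext
    (fun n => κ * μ * n / (X.fundamental n * Y.fundamental n)) (fun _ => κ) (fun _ => μ)
    (fun n hn => by have := hf n hn; have : (0 : ℝ) < n := Nat.cast_pos.2 hn; positivity)
    (fun _ _ => hκ) (fun _ _ => hμ)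
    (fun n hn x y => by
      refine (sum_mul_le_twoNorm n x y).trans ?_
      rw [div_mul_eq_mul_div, div_mul_eq_mul_div, le_div_iff₀ (hf n hn)]
      have h5 := mul_le_mul (h2 n x) (h4 n y)
        (mul_nonneg (twoNorm_nonneg _ _) (Y.fundamental_nonneg n)) (by positivity)
      have h6 := Real.mul_self_sqrt (Nat.cast_nonneg (α := ℝ) n)
      calc _ = twoNorm n x * X.fundamental n * (twoNorm n y * Y.fundamental n) := by ring
        _ ≤ _ := h5
        _ = κ * μ * (Real.sqrt n * Real.sqrt n) * ‖x‖ * ‖y‖ := by ring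
        _ = _ := by rw [h6])
    (fun n _ a => h1 n a) (fun n _ a => h3 n a)
  refine ⟨D * (κ * μ * (κ * μ)), fun n hn => ?_⟩
  have h5 := hD n hn
  have hn' : (0 : ℝ) < n := Nat.cast_pos.2 hn
  have h6 := hf n hn
  have e : D * (κ * μ * n / (X.fundamental n * Y.fundamental n) * (κ * μ)) =
      n * (D * (κ * μ * (κ * μ))) / (X.fundamental n * Y.fundamental n) := by ring
  rw [e, le_div_iff₀ h6] at h5
  exact le_of_mul_le_mul_left h5 hn'

theorem norm_trunc_le_of_sqrt_mul_le {κ : ℝ} {n : ℕ} (hn : 0 < n) {a : ℕ → 𝕜}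
    (h : Real.sqrt n * ‖X.trunc n a‖ ≤ κ * (twoNorm n a * X.fundamental n)) :
    ‖X.trunc n a‖ ≤ κ * X.fundamental n / Real.sqrt n * twoNorm n a := by
  have hs : 0 < Real.sqrt n := Real.sqrt_pos.2 (Nat.cast_pos.2 hn)
  rw [div_mul_eq_mul_div, le_div_iff₀ hs]
  linarith

theorem sq_le_fundamental_mul_fundamental_of_twoConcave (hX : X.IsSymmetric)
    (hY : Y.IsSymmetric) (hX2 : X.IsTwoConcave) (hY2 : Y.IsTwoConcave)
    (hext : ∀ T : X →L[𝕜] Y →L[𝕜] 𝕜, IsDiagonal T → IsExtendible T) :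
    ∃ C : ℝ, 0 < C ∧ ∀ n : ℕ, 0 < n → (n : ℝ) * n ≤ C * (X.fundamental n * Y.fundamental n) := by
  obtain ⟨κ, hκ, h1, h2⟩ := hX2.estimates hX
  obtain ⟨μ, hμ, h3, h4⟩ := hY2.estimates hY
  have hfX : ∀ n, 0 < n → 0 < X.fundamental n := fun n hn =>
    one_pos.trans_le (X.one_le_fundamental hn)
  have hfY : ∀ n, 0 < n → 0 < Y.fundamental n := fun n hn =>
    one_pos.trans_le (Y.one_le_fundamental hn)
  have hs : ∀ n : ℕ, 0 < n → 0 < Real.sqrt n := fun n hn => Real.sqrt_pos.2 (Nat.cast_pos.2 hn)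
  obtain ⟨D, hD⟩ := exists_le_of_forall_isExtendible hext (fun _ => κ * μ)
    (fun n => κ * X.fundamental n / Real.sqrt n) (fun n => μ * Y.fundamental n / Real.sqrt n)
    (fun _ _ => by positivity)
    (fun n hn => by have := hfX n hn; have := hs n hn; positivity)
    (fun n hn => by have := hfY n hn; have := hs n hn; positivity)
    (fun n hn x y => by
      refine (sum_mul_le_twoNorm n x y).trans ?_
      refine (mul_le_mul (h1 n x) (h3 n y) (twoNorm_nonneg _ _) (by positivity)).trans_eq ?_
      ring)
    (fun n hn a => norm_trunc_le_of_sqrt_mul_le hn (h2 n a))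
    (fun n hn a => norm_trunc_le_of_sqrt_mul_le hn (h4 n a))
  refine ⟨max 1 (D * (κ * μ * (κ * μ))), by positivity, fun n hn => ?_⟩
  have h5 := hD n hn
  have hn' : (0 : ℝ) < n := Nat.cast_pos.2 hn
  have e : D * (κ * μ * (κ * X.fundamental n / Real.sqrt n * (μ * Y.fundamental n / Real.sqrt n)))
      = D * (κ * μ * (κ * μ)) * (X.fundamental n * Y.fundamental n) /
        (Real.sqrt n * Real.sqrt n) := by ring
  rw [e, Real.mul_self_sqrt hn'.le, le_div_iff₀ hn'] at h5
  refine h5.trans (mul_le_mul_of_nonneg_right (le_max_right _ _) ?_)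
  exact (mul_pos (hfX n hn) (hfY n hn)).le

/-- If `X` is `2`-convex and `Y` is `2`-concave, then extendibility of all diagonal forms would
force `Y = ℓ₁`. In that case the sections of `∑ xₖ yₖ` are uniformly bounded and the first `n` unit
vectors of `Y` have weak `ℓ₂`-norm at most `√n`, so that `n ≤ C √n` for all `n`. -/
theorem not_forall_isExtendible_of_twoConvex_of_twoConcave (hX : X.IsSymmetric)
    (hY : Y.IsSymmetric) (hX2 : X.IsTwoConvex) (hY2 : Y.IsTwoConcave) :
    ¬ ∀ T : X →L[𝕜] Y →L[𝕜] 𝕜, IsDiagonal T → IsExtendible T := by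
  intro hext
  obtain ⟨κ, hκ, h1, h2⟩ := hX2.estimates hX
  obtain ⟨μ, hμ, h3, h4⟩ := hY2.estimates hY
  have hfX : ∀ n, 0 < n → 0 < X.fundamental n := fun n hn =>
    one_pos.trans_le (X.one_le_fundamental hn)
  have hfY : ∀ n, 0 < n → 0 < Y.fundamental n := fun n hn =>
    one_pos.trans_le (Y.one_le_fundamental hn)
  have hs : ∀ n : ℕ, 0 < n → 0 < Real.sqrt n := fun n hn => Real.sqrt_pos.2 (Nat.cast_pos.2 hn)
  obtain ⟨D, hD⟩ := exists_le_of_forall_isExtendible hext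
    (fun n => κ * μ * Real.sqrt n / X.fundamental n)
    (fun _ => κ) (fun n => μ * Y.fundamental n / Real.sqrt n)
    (fun n hn => by have := hfX n hn; have := hs n hn; positivity)
    (fun _ _ => hκ)
    (fun n hn => by have := hfY n hn; have := hs n hn; positivity)
    (fun n hn x y => by
      refine (sum_mul_le_twoNorm n x y).trans ?_
      rw [div_mul_eq_mul_div, div_mul_eq_mul_div, le_div_iff₀ (hfX n hn)]
      calc _ = twoNorm n x * X.fundamental n * twoNorm n y := by ring
        _ ≤ (κ * Real.sqrt n * ‖x‖) * (μ * ‖y‖) :=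
          mul_le_mul (h2 n x) (h3 n y) (twoNorm_nonneg _ _) (by positivity)
        _ = _ := by ring)
    (fun n _ a => h1 n a)
    (fun n hn a => norm_trunc_le_of_sqrt_mul_le hn (h4 n a))
  set C := max 1 (D * (κ * μ * (κ * μ))) with hC
  have hC0 : 0 < C := by positivity
  have hCY : ∀ n : ℕ, 0 < n → n ≤ C * Y.fundamental n := by
    intro n hn
    have h5 := hD n hn
    have h6 := hfX n hn
    have h7 := hs n hn
    have e : D * (κ * μ * Real.sqrt n / X.fundamental n *
        (κ * (μ * Y.fundamental n / Real.sqrt n))) =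
        D * (κ * μ * (κ * μ)) * Y.fundamental n / X.fundamental n := by
      field_simp
    rw [e, le_div_iff₀ h6] at h5
    have h8 : (n : ℝ) ≤ n * X.fundamental n :=
      le_mul_of_one_le_right (Nat.cast_nonneg _) (X.one_le_fundamental hn)
    exact (h8.trans h5).trans (mul_le_mul_of_nonneg_right (le_max_right _ _) (hfY n hn).le)
  obtain ⟨D', hD'⟩ := exists_le_of_forall_isExtendible hext (fun _ => C) (fun _ => κ)
    (fun n => Real.sqrt n) (fun _ _ => hC0) (fun _ _ => hκ) hs
    (fun n _ x y => by
      calc ∑ k ∈ Finset.range n, ‖x k‖ * ‖y k‖ ≤ ∑ k ∈ Finset.range n, ‖x‖ * ‖y k‖ :=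
            Finset.sum_le_sum fun k _ =>
              mul_le_mul_of_nonneg_right (X.norm_apply_le x k) (norm_nonneg _)
        _ = ‖x‖ * ∑ k ∈ Finset.range n, ‖y k‖ := by rw [Finset.mul_sum]
        _ ≤ ‖x‖ * (C * ‖y‖) :=
            mul_le_mul_of_nonneg_left (hY.sum_norm_le hCY n y) (norm_nonneg _)
        _ = _ := by ring)
    (fun n _ a => h1 n a)
    (fun n _ a => by
      refine (Y.norm_trunc_le_sum n a).trans ?_
      have := sum_mul_le_twoNorm n (fun _ => (1 : 𝕜)) a
      simpa [twoNorm] using this)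
  have key : ∀ n : ℕ, 0 < n → Real.sqrt n ≤ D' * C * κ := by
    intro n hn
    have h5 := hD' n hn
    refine le_of_mul_le_mul_right ?_ (hs n hn)
    rw [Real.mul_self_sqrt (Nat.cast_nonneg _)]
    linarith
  obtain ⟨n, hn⟩ := exists_nat_gt ((D' * C * κ) ^ 2 + 1)
  have hn0 : 0 < n := by
    have : (0 : ℝ) < n := lt_of_le_of_lt (by positivity) hn
    exact_mod_cast this
  have h5 := pow_le_pow_left₀ (Real.sqrt_nonneg _) (key n hn0) 2
  rw [Real.sq_sqrt (Nat.cast_nonneg _)] at h5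
  linarith

end necessity

/-! ### Sufficiency -/

section sufficiency

variable {𝕜 : Type u} [RCLike 𝕜] {X Y : BanachSeqSpace 𝕜}

theorem IsEllOne.exists_sum_le (hX : X.IsEllOne) :
    ∃ C : ℝ, 0 ≤ C ∧ ∀ (n : ℕ) (x : X), ∑ k : Fin n, ‖x k‖ ≤ C * ‖x‖ := by
  obtain ⟨hc, c, _, hc0, -, h⟩ := hX
  refine ⟨c⁻¹, by positivity, fun n x => ?_⟩
  have hs : Summable fun n => ‖x n‖ := by
    have : (x : ℕ → 𝕜) ∈ (X.carrier : Set (ℕ → 𝕜)) := x.2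
    rw [hc] at this
    exact this
  rw [← div_eq_inv_mul, le_div_iff₀ hc0, mul_comm, ← Finset.sum_range (fun k => ‖x k‖)]
  refine le_trans ?_ (h x).1
  exact mul_le_mul_of_nonneg_left (hs.sum_le_tsum _ fun _ _ => norm_nonneg _) hc0.le

theorem norm_signSum_coord_le {C A : ℝ} (hC0 : 0 ≤ C) {n : ℕ}
    (hC : ∀ x : X, ∑ k : Fin n, ‖x k‖ ≤ C * ‖x‖) (hA0 : 0 ≤ A) {α : ℕ → 𝕜}
    (hα : ∀ k, ‖α k‖ ≤ A) (ε : Fin n → Bool) :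
    ‖signSum (𝕜 := 𝕜) (fun i : Fin n => α i • X.coord i) ε‖ ≤ A * C := by
  refine ContinuousLinearMap.opNorm_le_bound _ (by positivity) fun x => ?_
  simp only [signSum, sum_apply, smul_apply, coord_apply]
  refine (norm_sum_le _ _).trans ?_
  rw [mul_assoc]
  refine le_trans ?_ (mul_le_mul_of_nonneg_left (hC x) hA0)
  rw [Finset.mul_sum]
  refine Finset.sum_le_sum fun i _ => ?_
  rw [norm_smul, norm_smul, norm_boolSign, one_mul]
  exact mul_le_mul_of_nonneg_right (hα i) (norm_nonneg _)

/-- On `ℓ₁ × ℓ₁` the sections of a diagonal form are the averages over all signs `ε` of the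
products of the functionals `∑ εₖ αₖ xₖ` and `∑ εₖ yₖ`, which are uniformly bounded. -/
theorem IsEllOne.isExtendible (hX : X.IsEllOne) (hY : Y.IsEllOne)
    {T : X →L[𝕜] Y →L[𝕜] 𝕜} (hT : IsDiagonal T) : IsExtendible T := by
  obtain ⟨α, hα⟩ := hT
  obtain ⟨C, hC0, hC⟩ := hX.exists_sum_le
  obtain ⟨C', hC0', hC'⟩ := hY.exists_sum_le
  have hαT : ∀ k, ‖α k‖ ≤ ‖T‖ := by
    intro k
    rw [← apply_unitVec_unitVec_of_tendsto hα]
    have := T.le_opNorm₂ (X.unitVec k) (Y.unitVec k)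
    rwa [norm_unitVec, norm_unitVec, mul_one, mul_one] at this
  intro E F _ _ _ _ _ _ i j
  have hB : ∀ n : ℕ, ∃ B : E →L[𝕜] F →L[𝕜] 𝕜,
      (∀ x y, B (i x) (j y) = ∑ k ∈ Finset.range n, α k * x k * y k) ∧
      ∀ e f, ‖B e f‖ ≤ 1 * (‖T‖ * C * (1 * C')) * ‖e‖ * ‖f‖ := by
    intro n
    obtain ⟨B, hB, hBC⟩ := exists_extension_finite_sum i j
      (fun _ : Fin n → Bool => ((2 : 𝕜) ^ n)⁻¹)
      (fun ε => signSum (𝕜 := 𝕜) (fun k : Fin n => α k • X.coord k) ε)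
      (fun ε => signSum (𝕜 := 𝕜) (fun k : Fin n => (1 : 𝕜) • Y.coord k) ε)
      (norm_signSum_coord_le hC0 (hC n) (norm_nonneg T) hαT)
      (norm_signSum_coord_le hC0' (hC' n) zero_le_one (α := fun _ => (1 : 𝕜))
        fun _ => by simp) (C := 1) (by simp) (by positivity) (by positivity)
    refine ⟨B, fun x y => ?_, hBC⟩
    rw [hB, ← Finset.mul_sum]
    have h1 := sum_signs_bilin (LinearMap.mul 𝕜 𝕜) (fun k : Fin n => α k * x k)
      (fun k : Fin n => y k)
    simp only [LinearMap.mul_apply'] at h1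
    rw [← Finset.sum_range (fun k => α k * x k * y k)] at h1
    rw [inv_mul_eq_iff_eq_mul₀ (by simp), ← h1]
    refine Finset.sum_congr rfl fun ε _ => ?_
    simp [signSum]
  choose B hB hBC using hB
  refine exists_extension_of_tendsto i j T B hBC fun x y => ?_
  simp only [hB]
  exact hα x y

theorem exists_norm_trunc_le (hX : X.IsCZero ∨ X.IsEllInfty) :
    ∃ C : ℝ, 0 < C ∧ ∀ (n : ℕ) (a : ℕ → 𝕜), (∀ k, ‖a k‖ ≤ 1) → ‖X.trunc n a‖ ≤ C := by
  have key : ∀ C : ℝ, 0 < C → (∀ x : X, ‖x‖ ≤ C * ⨆ k, ‖x k‖) →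
      ∀ (n : ℕ) (a : ℕ → 𝕜), (∀ k, ‖a k‖ ≤ 1) → ‖X.trunc n a‖ ≤ C := by
    intro C hC h n a ha
    refine (h _).trans (mul_le_of_le_one_right hC.le (ciSup_le fun k => ?_))
    rw [trunc_apply]
    split_ifs
    · exact ha k
    · simp
  rcases hX with ⟨-, c, C, -, hC, h⟩ | ⟨-, c, C, -, hC, h⟩ <;>
  exact ⟨C, hC, key C hC fun x => (h x).2⟩

/-- Diagonal forms on the spaces `c₀` and `ℓ_∞` have summable coefficients. -/
theorem isExtendible_of_isCZero_or_isEllInfty (hX : X.IsCZero ∨ X.IsEllInfty)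
    (hY : Y.IsCZero ∨ Y.IsEllInfty) {T : X →L[𝕜] Y →L[𝕜] 𝕜} (hT : IsDiagonal T) :
    IsExtendible T := by
  obtain ⟨α, hα⟩ := hT
  obtain ⟨C, hC0, hC⟩ := exists_norm_trunc_le hX
  obtain ⟨C', hC0', hC'⟩ := exists_norm_trunc_le hY
  have hαT : ∀ n : ℕ, ∑ k : Fin n, ‖α k‖ ≤ ‖T‖ * C * C' := by
    intro n
    -- the sequence of phases, with `αₖ aₖ = |αₖ|` also where `αₖ = 0`
    set a : ℕ → 𝕜 := fun k => starRingEnd 𝕜 (α k) * ((‖α k‖⁻¹ : ℝ) : 𝕜) with ha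
    have ha1 : ∀ k, ‖a k‖ ≤ 1 := by
      intro k
      simp only [ha, norm_mul, RCLike.norm_conj, RCLike.norm_ofReal, abs_inv, abs_norm]
      exact mul_inv_le_one
    have h1 := apply_trunc_trunc_of_tendsto hα n a (fun _ => 1)
    have h2 : ∀ k, α k * a k * 1 = ((‖α k‖ : ℝ) : 𝕜) := by
      intro k
      rw [mul_one, ← mul_assoc, RCLike.mul_conj]
      by_cases h : α k = 0
      · simp [h]
      · have h3 : ((‖α k‖ : ℝ) : 𝕜) ≠ 0 := by simpa using h
        push_cast
        field_simp
    simp only [h2, ← RCLike.ofReal_sum] at h1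
    have h3 := T.le_opNorm₂ (X.trunc n a) (Y.trunc n fun _ => 1)
    rw [h1, RCLike.norm_ofReal] at h3
    rw [← Finset.sum_range (fun k => ‖α k‖)]
    refine ((le_abs_self _).trans h3).trans ?_
    gcongr
    · exact hC n a ha1
    · exact hC' n _ fun _ => by simp
  intro E F _ _ _ _ _ _ i j
  have hB : ∀ n : ℕ, ∃ B : E →L[𝕜] F →L[𝕜] 𝕜,
      (∀ x y, B (i x) (j y) = ∑ k ∈ Finset.range n, α k * x k * y k) ∧
      ∀ e f, ‖B e f‖ ≤ ‖T‖ * C * C' * (1 * 1) * ‖e‖ * ‖f‖ := by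
    intro n
    obtain ⟨B, hB, hBC⟩ := exists_extension_finite_sum i j (fun k : Fin n => α k)
      (fun k => X.coord k) (fun k => Y.coord k) (fun k => X.norm_coord_le k)
      (fun k => Y.norm_coord_le k) (hαT n) zero_le_one zero_le_one
    refine ⟨B, fun x y => ?_, hBC⟩
    rw [hB, Finset.sum_range]
    simp [mul_assoc]
  choose B hB hBC using hB
  refine exists_extension_of_tendsto i j T B hBC fun x y => ?_
  simp only [hB]
  exact hα x y

end sufficiency

end BanachSeqSpace

theorem mainTheorem5 {𝕜 : Type u} [RCLike 𝕜] (X Y : BanachSeqSpace 𝕜)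
    (hX : X.IsSymmetric) (hY : Y.IsSymmetric)
    (hX2 : X.IsTwoConvex ∨ X.IsTwoConcave) (hY2 : Y.IsTwoConvex ∨ Y.IsTwoConcave) :
    (∀ T : X →L[𝕜] Y →L[𝕜] 𝕜, BanachSeqSpace.IsDiagonal T → IsExtendible T) ↔
      ((X.IsEllOne ∧ Y.IsEllOne) ∨
        ((X.IsCZero ∨ X.IsEllInfty) ∧ (Y.IsCZero ∨ Y.IsEllInfty))) := by
  constructor
  · intro hext
    rcases hX2 with hX2 | hX2 <;> rcases hY2 with hY2 | hY2
    · right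
      obtain ⟨C, hC⟩ :=
        BanachSeqSpace.fundamental_mul_fundamental_le_of_twoConvex hX hY hX2 hY2 hext
      have h0 : ∀ Z : BanachSeqSpace 𝕜, Z.fundamental 0 = 0 := fun Z =>
        le_antisymm (by simpa using Z.fundamental_le 0) (Z.fundamental_nonneg 0)
      have hC0 : 0 ≤ C := le_trans
        (mul_nonneg (X.fundamental_nonneg 1) (Y.fundamental_nonneg 1)) (hC 1 one_pos)
      constructor
      · refine hX.isCZero_or_isEllInfty (C := C) fun n => ?_
        rcases Nat.eq_zero_or_pos n with rfl | hn
        · rwa [h0]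
        · exact (le_mul_of_one_le_right (X.fundamental_nonneg n)
            (Y.one_le_fundamental hn)).trans (hC n hn)
      · refine hY.isCZero_or_isEllInfty (C := C) fun n => ?_
        rcases Nat.eq_zero_or_pos n with rfl | hn
        · rwa [h0]
        · exact (le_mul_of_one_le_left (Y.fundamental_nonneg n)
            (X.one_le_fundamental hn)).trans (hC n hn)
    · exact absurd hext
        (BanachSeqSpace.not_forall_isExtendible_of_twoConvex_of_twoConcave hX hY hX2 hY2)
    · exact absurd (BanachSeqSpace.isExtendible_flip_of_forall hext)
        (BanachSeqSpace.not_forall_isExtendible_of_twoConvex_of_twoConcave hY hX hY2 hX2)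
    · left
      obtain ⟨C, hC0, hC⟩ :=
        BanachSeqSpace.sq_le_fundamental_mul_fundamental_of_twoConcave hX hY hX2 hY2 hext
      constructor
      · refine hX.isEllOne hC0 fun n hn => ?_
        have hn' : (0 : ℝ) < n := Nat.cast_pos.2 hn
        refine le_of_mul_le_mul_right ((hC n hn).trans ?_) hn'
        rw [← mul_assoc]
        exact mul_le_mul_of_nonneg_left (Y.fundamental_le n)
          (mul_nonneg hC0.le (X.fundamental_nonneg n))
      · refine hY.isEllOne hC0 fun n hn => ?_
        have hn' : (0 : ℝ) < n := Nat.cast_pos.2 hn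
        refine le_of_mul_le_mul_left ((hC n hn).trans ?_) hn'
        rw [mul_left_comm]
        exact mul_le_mul_of_nonneg_right (X.fundamental_le n)
          (mul_nonneg hC0.le (Y.fundamental_nonneg n))
  · rintro (⟨h1, h2⟩ | ⟨h1, h2⟩) T hT
    · exact h1.isExtendible h2 hT
    · exact BanachSeqSpace.isExtendible_of_isCZero_or_isEllInfty h1 h2 hT
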